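/- **Games.** A game $G=(M_G,\lambda_G,P^m_G,\frown_G)$ consists of a set $M_G$ of moves, a labelling $\lambda_G:M_G\to\{P,O\}\times\{Q,A\}$ (Player/Opponent, question/answer), a binary coherence relation $\frown_G$ on answers that is reflexive on answers and relates only answers with the same label, and a finite set $P^m_G\subseteq M_G^\star$ of finite sequences (maximal positions), none of which is a proper prefix of another. Write $\mathrm{ans}(s)$, $\mathrm{oans}(s)$, $\mathrm{pans}(s)$ for the sets of answers, $O$-answers, $P$-answers in $s$; an $O$-clique ($P$-clique) is a set of pairwise coherent $O$-answers ($P$-answers); $\mathrm{Pref}(S)$ is the prefix closure of $S$ and $\preceq$ the prefix order. Every $s\in P^m_G$ satisfies: polarities alternate and the first move (if any) is by $O$; no prefix of $s$ has more answers than questions, and $s$ has equally many of both; $\mathrm{ans}(s)$ is the union of a maximal $O$-clique and a maximal $P$-clique. Moreover (extension), if $s\in\mathrm{Pref}(P^m_G)$ and $v$, $w$ are a maximal $O$-clique and a maximal $P$-clique with $\mathrm{ans}(s)\subseteq v\cup w$, then there is $s'\in P^m_G$ with $s\preceq s'$ and $\mathrm{ans}(s')=v\cup w$. **Linear implication.**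 $G\multimap H$ has moves $M_G\uplus M_H$, the labels of $H$ and the labels of $G$ with $P$ and $O$ exchanged; coherence is that of $G$ and of $H$, and answers with the same label in different components are coherent; its maximal positions are all sequences that alternate in polarity, start with $O$ (if non-empty), and project to $P^m_G$ and to $P^m_H$. **Strategies.** Let $\mathcal H(X)$ be the complex vector space with basis the finite set $X$; for $\sigma\in\mathcal H(X)$ write $(z,s)\in\sigma$ if $z\neq0$ is the coefficient of $s$ in $\sigma$, and $\mathrm{Pref}(\sigma)$ for the set of prefixes of sequences $s$ with a non-zero coefficient. A strategy $\sigma:G$ is an element of $\mathcal H(P^m_G)$ such that 1. (determinacy) if $s\in\mathrm{Pref}(\sigma)$ has even length and $sm\in\mathrm{Pref}(P^m_G)$, there is a unique $n$ with $smn\in\mathrm{Pref}(\sigma)$; 2. (monotonicity) if $(z,t)\in\sigma$, $sm\in\mathrm{Pref}(\sigma)$ with $s$ of odd length, and $\mathrm{ans}(s)\subseteq\mathrm{ans}(t)$, then $\mathrm{ans}(sm)\subseteq\mathrm{ans}(t)$; 3. (preservation of incoherence) if $sm,s'm'\in\mathrm{Pref}(\sigma)$, where $m,m'$ are incoherent $O$-answers,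 and $t,t'\in\mathrm{Pref}(\sigma)\cap P^m_G$ with $sm\preceq t$, $s'm'\preceq t'$, then there are incoherent $P$-answers $n,n'$ and sequences $r,r'$ with $smrn\preceq t$ and $s'm'r'n'\preceq t'$. **Equivalence.** For a strategy $\sigma:G$ let $f_\sigma$ be the relation with graph $\{(\mathrm{oans}(s),z,\mathrm{pans}(s)) : (z,s)\in\sigma\}$. The scalar of $f_\sigma$ is well defined if $(z,s),(z',s')\in\sigma$ with $\mathrm{oans}(s)=\mathrm{oans}(s')$ and $\mathrm{pans}(s)=\mathrm{pans}(s')$ implies $z=z'$. Write $\sigma\approx\sigma'$ if $f_\sigma$ and $f_{\sigma'}$ have well-defined scalars and the same graph. **Composition.** For $\sigma:G\multimap H$ and $\tau:H\multimap K$ let $\sigma\,\|\,\tau$ assign to each sequence $u\in(M_G\uplus M_H\uplus M_K)^\star$ the product of the coefficient of $u\!\downharpoonright\! G,H$ in $\sigma$ and that of $u\!\downharpoonright\! H,K$ in $\tau$; and let $\sigma;\tau$ assign to each $s\in(M_G\uplus M_K)^\star$ the sum of $(\sigma\,\|\,\tau)(u)$ over all $u$ with $u\!\downharpoonright\! G,K=s$.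 **Lemma (composition is well defined).** Let $G,H,K$ be games, $\sigma,\sigma':G\multimap H$ and $\tau,\tau':H\multimap K$ strategies. Then $\sigma;\tau$ and $\sigma';\tau'$ are strategies on $G\multimap K$; that is, they are elements of $\mathcal H(P^m_{G\multimap K})$ satisfying determinacy, monotonicity and preservation of incoherence. If moreover $\sigma\approx\sigma'$ and $\tau\approx\tau'$, then $\sigma;\tau\approx\sigma';\tau'$. -/

import Mathlib

namespace QGames

/-- The two protagonists: Player `P` and Opponent `O`. -/
inductive Polarity where
  | P : Polarity
  | O : Polarity

/-- Exchange of the two protagonists. -/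
def Polarity.flip : Polarity → Polarity
  | Polarity.P => Polarity.O
  | Polarity.O => Polarity.P

/-- Moves are questions `Q` or answers `A`. -/
inductive Kind where
  | Q : Kind
  | A : Kind

def Kind.isQ : Kind → Bool
  | Kind.Q => true
  | Kind.A => false

def Kind.isA : Kind → Bool
  | Kind.Q => false
  | Kind.A => true

/-- The set of all prefixes of the sequences in `S`. -/
def Pref {M : Type*} (S : Set (List M)) : Set (List M) :=
  {s | ∃ t ∈ S, s <+: t}

/-- The data `(M, label, P^m, coh)` of a game with set of moves `M`: a labelling of the moves, a set
of maximal positions, and a coherence relation. -/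
structure GameData (M : Type*) where
  label : M → Polarity × Kind
  maxPos : Set (List M)
  coh : M → M → Prop

namespace GameData

variable {M : Type*} (D : GameData M)

def IsAnswer (m : M) : Prop := (D.label m).2 = Kind.A

/-- `m` is an answer of the protagonist `p`. -/
def IsAnswerOf (p : Polarity) (m : M) : Prop := D.label m = (p, Kind.A)

/-- The set of answers occurring in `s`. -/
def ans (s : List M) : Set M := {m | m ∈ s ∧ D.IsAnswer m}

/-- The set of answers of the protagonist `p` occurring in `s`
(`oans` for `p = O`, `pans` for `p = P`). -/
def ansOf (p : Polarity) (s : List M) : Set M := {m | m ∈ s ∧ D.IsAnswerOf p m}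

/-- A `p`-clique: a set of pairwise coherent answers of the protagonist `p`. -/
def IsClique (p : Polarity) (v : Set M) : Prop :=
  (∀ m ∈ v, D.IsAnswerOf p m) ∧ ∀ m ∈ v, ∀ n ∈ v, D.coh m n

/-- A `p`-clique that is maximal for inclusion. -/
def IsMaxClique (p : Polarity) (v : Set M) : Prop := Maximal (D.IsClique p) v

/-- Polarities alternate, and the first move (if there is one) is by Opponent. -/
def Alternating (s : List M) : Prop :=
  ∀ (i : ℕ) (h : i < s.length), (D.label s[i]).1 = Polarity.O ↔ Even i

def numQ (s : List M) : ℕ := s.countP fun m => (D.label m).2.isQ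

def numA (s : List M) : ℕ := s.countP fun m => (D.label m).2.isA

/-- No prefix has more answers than questions, and the whole sequence has as many of either. -/
def WellBalanced (s : List M) : Prop :=
  (∀ p : List M, p <+: s → D.numA p ≤ D.numQ p) ∧ D.numQ s = D.numA s

/-- The axioms of a game. -/
structure IsGame : Prop where
  /-- coherence relates answers that carry the same label -/
  coh_answer : ∀ m n, D.coh m n → D.IsAnswer m ∧ D.IsAnswer n ∧ D.label m = D.label n
  /-- coherence is reflexive on answers -/
  coh_refl : ∀ m, D.IsAnswer m → D.coh m m
  finite : D.maxPos.Finite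
  /-- the elements of `maxPos` are maximal positions: none is a proper prefix of another -/
  maximal : ∀ s ∈ D.maxPos, ∀ t ∈ D.maxPos, s <+: t → s = t
  alternation : ∀ s ∈ D.maxPos, D.Alternating s
  wellBalanced : ∀ s ∈ D.maxPos, D.WellBalanced s
  completeness : ∀ s ∈ D.maxPos, ∃ v w : Set M,
    D.IsMaxClique Polarity.O v ∧ D.IsMaxClique Polarity.P w ∧ D.ans s = v ∪ w
  extension : ∀ s ∈ Pref D.maxPos, ∀ v w : Set M,
    D.IsMaxClique Polarity.O v → D.IsMaxClique Polarity.P w → D.ans s ⊆ v ∪ w →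
      ∃ t ∈ D.maxPos, s <+: t ∧ D.ans t = v ∪ w

/-- A vector of the Hilbert space on the finite set `maxPos` is given by its coordinates, extended
by `0` to all sequences of moves, so that `(z, s) ∈ σ` reads `z = σ s ∧ z ≠ 0`. This structure says
that such a vector `σ` is a strategy. -/
structure IsStrategy (σ : List M → ℂ) : Prop where
  mem_space : Function.support σ ⊆ D.maxPos
  determinacy : ∀ s ∈ Pref (Function.support σ), Even s.length →
    ∀ m, s ++ [m] ∈ Pref D.maxPos → ∃! n, s ++ [m, n] ∈ Pref (Function.support σ)
  /-- the move `m` is the response of the strategy (`s` has odd length); `s` need not be a prefix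
  of `t` -/
  monotonicity : ∀ t ∈ Function.support σ, ∀ (s : List M) (m : M), Odd s.length →
    s ++ [m] ∈ Pref (Function.support σ) → D.ans s ⊆ D.ans t → D.ans (s ++ [m]) ⊆ D.ans t
  incoherence_preservation : ∀ (s s' : List M) (m m' : M),
    s ++ [m] ∈ Pref (Function.support σ) → s' ++ [m'] ∈ Pref (Function.support σ) →
    D.IsAnswerOf Polarity.O m → D.IsAnswerOf Polarity.O m' → ¬ D.coh m m' →
    ∀ t ∈ Pref (Function.support σ) ∩ D.maxPos, ∀ t' ∈ Pref (Function.support σ) ∩ D.maxPos,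
      s ++ [m] <+: t → s' ++ [m'] <+: t' →
      ∃ (r r' : List M) (n n' : M),
        s ++ [m] ++ r ++ [n] <+: t ∧ s' ++ [m'] ++ r' ++ [n'] <+: t' ∧
        D.IsAnswerOf Polarity.P n ∧ D.IsAnswerOf Polarity.P n' ∧ ¬ D.coh n n'

/-- The graph of the partial function `f_σ`: it holds `(v, z, w)` when some `(z, s) ∈ σ` has
Opponent answers `v` and Player answers `w`. -/
def fnGraph (σ : List M → ℂ) : Set (Set M × ℂ × Set M) :=
  {x | ∃ s, σ s ≠ 0 ∧ x = (D.ansOf Polarity.O s, σ s, D.ansOf Polarity.P s)}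

/-- The scalar of `f_σ` is well defined: plays of `σ` with the same Opponent and Player answers
carry the same scalar. -/
def ScalarWellDefined (σ : List M → ℂ) : Prop :=
  ∀ s t, σ s ≠ 0 → σ t ≠ 0 → D.ansOf Polarity.O s = D.ansOf Polarity.O t →
    D.ansOf Polarity.P s = D.ansOf Polarity.P t → σ s = σ t

/-- Extensional equivalence `σ ≈ τ`: the functions `f_σ` and `f_τ` have well-defined scalars and
the same graph. -/
def ExtEquiv (σ τ : List M → ℂ) : Prop :=
  D.ScalarWellDefined σ ∧ D.ScalarWellDefined τ ∧ D.fnGraph σ = D.fnGraph τ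

end GameData

/-- A game with set of moves `M`. -/
structure Game (M : Type*) extends GameData M where
  isGame : toGameData.IsGame

section Implication

variable {A B : Type*}

def restrictLeft (s : List (A ⊕ B)) : List A := s.filterMap Sum.getLeft?

def restrictRight (s : List (A ⊕ B)) : List B := s.filterMap Sum.getRight?

/-- The labelling of `G ⊸ H`: polarities are exchanged in `G`. -/
def limpLabel (G : GameData A) (H : GameData B) : A ⊕ B → Polarity × Kind
  | Sum.inl a => ((G.label a).1.flip, (G.label a).2)
  | Sum.inr b => H.label b

/-- The coherence of `G ⊸ H`: that of the components, and answers (with the same label) from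
different components are coherent. -/
def limpCoh (G : GameData A) (H : GameData B) : A ⊕ B → A ⊕ B → Prop
  | Sum.inl a, Sum.inl a' => G.coh a a'
  | Sum.inr b, Sum.inr b' => H.coh b b'
  | m, n => (limpLabel G H m).2 = Kind.A ∧ (limpLabel G H n).2 = Kind.A ∧
      limpLabel G H m = limpLabel G H n

/-- Linear implication `G ⊸ H`. The maximal positions are all the alternating sequences that
project to maximal positions of both components (such a sequence is automatically well balanced). -/
def limp (G : GameData A) (H : GameData B) : GameData (A ⊕ B) where
  label := limpLabel G H
  maxPos := {s | (∀ (i : ℕ) (h : i < s.length),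
      (limpLabel G H s[i]).1 = Polarity.O ↔ Even i) ∧
    restrictLeft s ∈ G.maxPos ∧ restrictRight s ∈ H.maxPos}
  coh := limpCoh G H

end Implication

section Composition

variable {A B C : Type*}

/-- The restriction to the first two components. -/
def restrict12 (u : List (A ⊕ B ⊕ C)) : List (A ⊕ B) :=
  u.filterMap fun
    | Sum.inl a => some (Sum.inl a)
    | Sum.inr (Sum.inl b) => some (Sum.inr b)
    | Sum.inr (Sum.inr _) => none

/-- The restriction to the last two components. -/
def restrict23 (u : List (A ⊕ B ⊕ C)) : List (B ⊕ C) :=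
  u.filterMap Sum.getRight?

/-- The restriction to the outer components. -/
def restrict13 (u : List (A ⊕ B ⊕ C)) : List (A ⊕ C) :=
  u.filterMap fun
    | Sum.inl a => some (Sum.inl a)
    | Sum.inr (Sum.inl _) => none
    | Sum.inr (Sum.inr c) => some (Sum.inr c)

/-- Parallel composition `σ || τ`: a sequence `u` over the three sets of moves has the scalar `z w`
when `(z, u ↾ G,H) ∈ σ` and `(w, u ↾ H,K) ∈ τ`, and the scalar `0` otherwise. -/
def par (σ : List (A ⊕ B) → ℂ) (τ : List (B ⊕ C) → ℂ) (u : List (A ⊕ B ⊕ C)) : ℂ :=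
  σ (restrict12 u) * τ (restrict23 u)

/-- Composition `σ ; τ`: parallel composition followed by the restriction of the sequences to the
outer components. The scalars of the sequences with the same restriction are added; when `σ` and
`τ` have finite supports, only finitely many of them are nonzero. -/
noncomputable def comp (σ : List (A ⊕ B) → ℂ) (τ : List (B ⊕ C) → ℂ) (s : List (A ⊕ C)) : ℂ :=
  ∑ᶠ u ∈ {u : List (A ⊕ B ⊕ C) | restrict13 u = s}, par σ τ u

end Composition

end QGames

namespace QGames

/-! ### Prefixes of lists and of sets of lists. -/

section Lists

variable {M N : Type*}

/-! Everything takes place on interaction sequences over the three sets of moves whose two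
restrictions are prefixes of plays of `σ` and of `τ` (`Compatible`). Let a, b, c be the lengths of
such a sequence in G, H, K. Alternation in the two implications forces: a odd implies b odd, and b
odd implies c odd. Only four parity states remain, and each determines who moves next: Opponent in K
(even, even, even), `τ` (even, even, odd), `σ` (even, odd, odd), Opponent in G (odd, odd, odd).

Two consequences carry the proof. There is no deadlock: in each state a move is available or the
interaction is complete, and since games are finite every compatible sequence extends to a complete
interaction (`Compatible.exists_extension`). Further, two complete interactions can part only where
Opponent moves in an outer component (`exists_opponent_divergence`), because `σ` and `τ` respond
uniquely. So an interaction is determined by its visible part, the sum defining `comp` has at most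
one nonzero term, and determinacy follows.

Monotonicity is an invariant along an interaction: if the visible Opponent answers lie in a complete
interaction v, then monotonicity of `σ` and `τ` puts every later answer, hidden or visible, in v
(`Compatible.answers_mem`). For incoherence, each strategy turns incoherent incoming answers into
later incoherent outgoing ones; those in H are passed to the other strategy, and finiteness makes
the exchange end in an outer component (`exists_visible_incoherence`).

For equivalence, the visible answers determine the hidden ones, so scalars of composites are well
defined. Given an interaction u of `σ` and `τ`, the equivalent strategies are run against an
Opponent who, by the extension axiom, uses only answers of u. The result has its answers inside
those of u, and maximality of cliques gives equality (`exists_interaction_with_same_answers`). -/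

theorem prefix_filterMap_append_singleton {f : M → Option N} {u : List M} {s : List N} {n : N}
    (h : s ++ [n] <+: u.filterMap f) :
    ∃ w x, w ++ [x] <+: u ∧ w.filterMap f = s ∧ f x = some n := by
  induction u using List.reverseRecOn with
  | nil => simp at h
  | append_singleton u y ih =>
    by_cases h' : s ++ [n] <+: u.filterMap f
    · obtain ⟨w, x, hw, h1, h2⟩ := ih h'
      exact ⟨w, x, hw.trans (List.prefix_append _ _), h1, h2⟩
    · rw [List.filterMap_append] at h
      cases hy : f y with
      | none => simp [hy] at h; exact absurd h h'
      | some k =>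
        have hk : List.filterMap f [y] = [k] := by simp [hy]
        rw [hk, List.prefix_concat_iff] at h
        rcases h with h | h
        · obtain ⟨h1, h2⟩ := List.append_inj' h rfl
          simp only [List.cons.injEq, and_true] at h2
          exact ⟨u, y, List.prefix_rfl, h1.symm, by rw [hy, h2]⟩
        · exact absurd h h'

theorem prefix_or_prefix_or_diverge (u v : List M) :
    u <+: v ∨ v <+: u ∨ ∃ w x y, x ≠ y ∧ w ++ [x] <+: u ∧ w ++ [y] <+: v := by
  induction u generalizing v with
  | nil => exact Or.inl (List.nil_prefix)
  | cons a u ih =>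
    cases v with
    | nil => exact Or.inr (Or.inl List.nil_prefix)
    | cons b v =>
      by_cases hab : a = b
      · subst hab
        rcases ih v with h | h | ⟨w, x, y, hxy, h1, h2⟩
        · exact Or.inl ((List.prefix_cons_inj a).2 h)
        · exact Or.inr (Or.inl ((List.prefix_cons_inj a).2 h))
        · exact Or.inr (Or.inr ⟨a :: w, x, y, hxy, (List.prefix_cons_inj a).2 h1,
            (List.prefix_cons_inj a).2 h2⟩)
      · exact Or.inr (Or.inr ⟨[], a, b, hab, by simp, by simp⟩)

theorem exists_append_singleton_prefix {s t : List M} (h : s <+: t) (hne : s ≠ t) :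
    ∃ m, s ++ [m] <+: t := by
  obtain ⟨r, rfl⟩ := h
  cases r with
  | nil => simp at hne
  | cons m r => exact ⟨m, r, by simp⟩

theorem append_singleton_prefix_unique {s t : List M} {m n : M}
    (h₁ : s ++ [m] <+: t) (h₂ : s ++ [n] <+: t) : m = n := by
  have := (List.prefix_of_prefix_length_le h₁ h₂ (by simp)).eq_of_length (by simp)
  simpa using this

theorem prefix_of_append_singleton_prefix {s t : List M} {m : M} (h : s ++ [m] <+: t) :
    s <+: t := (List.prefix_append _ _).trans h

theorem mem_of_append_singleton_prefix {s t : List M} {m : M} (h : s ++ [m] <+: t) :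
    m ∈ t := h.subset (by simp)

theorem Pref.of_prefix {S : Set (List M)} {s t : List M} (ht : t ∈ Pref S) (h : s <+: t) :
    s ∈ Pref S := by
  obtain ⟨r, hr, htr⟩ := ht
  exact ⟨r, hr, h.trans htr⟩

theorem Pref.of_append_singleton {S : Set (List M)} {s : List M} {m : M}
    (h : s ++ [m] ∈ Pref S) : s ∈ Pref S := Pref.of_prefix h (List.prefix_append _ _)

theorem Pref.mono {S T : Set (List M)} (h : S ⊆ T) : Pref S ⊆ Pref T := by
  rintro s ⟨t, ht, hst⟩
  exact ⟨t, h ht, hst⟩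

theorem subset_Pref (S : Set (List M)) : S ⊆ Pref S := fun s hs => ⟨s, hs, List.prefix_rfl⟩

theorem exists_length_bound_of_finite {S : Set (List M)} (hS : S.Finite) :
    ∃ N, ∀ s ∈ Pref S, s.length ≤ N := by
  obtain ⟨N, hN⟩ := (hS.image List.length).bddAbove
  refine ⟨N, ?_⟩
  rintro s ⟨t, ht, hst⟩
  exact hst.length_le.trans (hN ⟨t, ht, rfl⟩)

theorem GameData.alternating_iff (D : GameData M) (s : List M) :
    D.Alternating s ↔
      ∀ p m, p ++ [m] <+: s → ((D.label m).1 = Polarity.O ↔ Even p.length) := by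
  constructor
  · rintro h p m ⟨r, rfl⟩
    simpa using h p.length (by simp)
  · intro h i hi
    have := h (s.take i) s[i] (by
      rw [List.take_append_getElem hi]; exact List.take_prefix _ _)
    rwa [List.length_take, min_eq_left hi.le] at this

end Lists

theorem Polarity.flip_eq_O_iff (p : Polarity) : p.flip = Polarity.O ↔ ¬ p = Polarity.O := by
  cases p <;> simp [Polarity.flip]

/-- Every move is a question or an answer, and a balanced sequence has equally many of each. -/
theorem Game.even_length {M : Type*} (G : Game M) {s : List M} (hs : s ∈ G.maxPos) :
    Even s.length := by
  have h := (G.isGame.wellBalanced s hs).2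
  have key : ∀ l : List M, l.length = G.toGameData.numQ l + G.toGameData.numA l := by
    intro l
    induction l with
    | nil => rfl
    | cons a l ih =>
      simp only [GameData.numQ, GameData.numA, List.countP_cons, List.length_cons] at ih ⊢
      rw [ih]
      cases (G.label a).2 <;> simp [Kind.isQ, Kind.isA] <;> omega
  rw [key s, h]
  exact ⟨_, rfl⟩

theorem Game.alternating_step {M : Type*} (G : Game M) {s : List M} {m : M}
    (h : s ++ [m] ∈ Pref G.maxPos) : (G.label m).1 = Polarity.O ↔ Even s.length := by
  obtain ⟨t, ht, hst⟩ := h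
  exact (G.toGameData.alternating_iff t).1 (G.isGame.alternation t ht) s m hst

/-! ### Parity and extension of positions in a linear implication. -/

section Implication

variable {A B : Type*}

@[simp] theorem restrictLeft_nil : restrictLeft ([] : List (A ⊕ B)) = [] := rfl

@[simp] theorem restrictRight_nil : restrictRight ([] : List (A ⊕ B)) = [] := rfl

@[simp] theorem restrictLeft_append (s t : List (A ⊕ B)) :
    restrictLeft (s ++ t) = restrictLeft s ++ restrictLeft t := List.filterMap_append

@[simp] theorem restrictRight_append (s t : List (A ⊕ B)) :
    restrictRight (s ++ t) = restrictRight s ++ restrictRight t := List.filterMap_append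

@[simp] theorem restrictLeft_inl (a : A) : restrictLeft [(Sum.inl a : A ⊕ B)] = [a] := rfl

@[simp] theorem restrictLeft_inr (b : B) : restrictLeft [(Sum.inr b : A ⊕ B)] = [] := rfl

@[simp] theorem restrictRight_inl (a : A) : restrictRight [(Sum.inl a : A ⊕ B)] = [] := rfl

@[simp] theorem restrictRight_inr (b : B) : restrictRight [(Sum.inr b : A ⊕ B)] = [b] := rfl

theorem restrictLeft_prefix {s t : List (A ⊕ B)} (h : s <+: t) :
    restrictLeft s <+: restrictLeft t := h.filterMap _

theorem restrictRight_prefix {s t : List (A ⊕ B)} (h : s <+: t) :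
    restrictRight s <+: restrictRight t := h.filterMap _

@[simp] theorem restrictLeft_map_inl (s : List A) :
    restrictLeft (s.map (Sum.inl : A → A ⊕ B)) = s := by
  induction s with
  | nil => rfl
  | cons a s ih => simpa [restrictLeft] using ih

@[simp] theorem restrictRight_map_inl (s : List A) :
    restrictRight (s.map (Sum.inl : A → A ⊕ B)) = [] := by
  induction s with
  | nil => rfl
  | cons a s ih => simp [restrictRight]

@[simp] theorem restrictLeft_map_inr (s : List B) :
    restrictLeft (s.map (Sum.inr : B → A ⊕ B)) = [] := by
  induction s with
  | nil => rfl
  | cons a s ih => simp [restrictLeft]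

@[simp] theorem restrictRight_map_inr (s : List B) :
    restrictRight (s.map (Sum.inr : B → A ⊕ B)) = s := by
  induction s with
  | nil => rfl
  | cons a s ih => simpa [restrictRight] using ih

theorem length_eq_restrict (s : List (A ⊕ B)) :
    s.length = (restrictLeft s).length + (restrictRight s).length := by
  induction s using List.reverseRecOn with
  | nil => rfl
  | append_singleton s x ih => cases x <;> simp <;> omega

theorem mem_restrictLeft {s : List (A ⊕ B)} {a : A} : a ∈ restrictLeft s ↔ Sum.inl a ∈ s := by
  simp [restrictLeft, List.mem_filterMap, Sum.getLeft?_eq_some_iff]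

theorem mem_restrictRight {s : List (A ⊕ B)} {b : B} :
    b ∈ restrictRight s ↔ Sum.inr b ∈ s := by
  simp [restrictRight, List.mem_filterMap, Sum.getRight?_eq_some_iff]

variable {G : Game A} {H : Game B}

local notation "GH" => limp (Game.toGameData G) (Game.toGameData H)

theorem limp_alternating {s : List (A ⊕ B)} (h : s ∈ (GH).maxPos) : (GH).Alternating s := h.1

theorem Pref.restrictLeft_mem {s : List (A ⊕ B)} (h : s ∈ Pref (GH).maxPos) :
    restrictLeft s ∈ Pref G.maxPos := by
  obtain ⟨t, ht, hst⟩ := h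
  exact ⟨_, ht.2.1, restrictLeft_prefix hst⟩

theorem Pref.restrictRight_mem {s : List (A ⊕ B)} (h : s ∈ Pref (GH).maxPos) :
    restrictRight s ∈ Pref H.maxPos := by
  obtain ⟨t, ht, hst⟩ := h
  exact ⟨_, ht.2.2, restrictRight_prefix hst⟩

theorem limp_alternating_step {s : List (A ⊕ B)} {m : A ⊕ B} (h : s ++ [m] ∈ Pref (GH).maxPos) :
    (limpLabel G.toGameData H.toGameData m).1 = Polarity.O ↔ Even s.length := by
  obtain ⟨t, ht, hst⟩ := h
  exact ((GH).alternating_iff t).1 (limp_alternating ht) s m hst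

/-- Opponent switches no components: a move on the left happens only between an Opponent move and
the following Player move on the right. -/
theorem odd_right_of_left_move {s : List (A ⊕ B)} {a : A}
    (h : s ++ [Sum.inl a] ∈ Pref (GH).maxPos) : Odd (restrictRight s).length := by
  have h1 := limp_alternating_step h
  have h2 := G.alternating_step (m := a) (s := restrictLeft s) (by simpa using Pref.restrictLeft_mem h)
  rw [length_eq_restrict s] at h1
  simp only [limpLabel, Polarity.flip_eq_O_iff, h2] at h1
  grind

theorem even_left_of_right_move {s : List (A ⊕ B)} {b : B}
    (h : s ++ [Sum.inr b] ∈ Pref (GH).maxPos) : Even (restrictLeft s).length := by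
  have h1 := limp_alternating_step h
  have h2 := H.alternating_step (m := b) (s := restrictRight s)
    (by simpa using Pref.restrictRight_mem h)
  rw [length_eq_restrict s] at h1
  simp only [limpLabel, h2] at h1
  grind

theorem odd_right_of_odd_left {s : List (A ⊕ B)} (h : s ∈ Pref (GH).maxPos)
    (hs : Odd (restrictLeft s).length) : Odd (restrictRight s).length := by
  induction s using List.reverseRecOn with
  | nil => simp at hs
  | append_singleton s x ih =>
    cases x with
    | inl a => simpa using odd_right_of_left_move h
    | inr b =>
      have := even_left_of_right_move h
      simp at hs
      grind

theorem limp_maximal {s t : List (A ⊕ B)} (hs : s ∈ (GH).maxPos) (ht : t ∈ (GH).maxPos)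
    (h : s <+: t) : s = t := by
  refine h.eq_of_length ?_
  rw [length_eq_restrict s, length_eq_restrict t,
    G.isGame.maximal _ hs.2.1 _ ht.2.1 (restrictLeft_prefix h),
    H.isGame.maximal _ hs.2.2 _ ht.2.2 (restrictRight_prefix h)]

theorem limp_even_length {s : List (A ⊕ B)} (hs : s ∈ (GH).maxPos) : Even s.length := by
  rw [length_eq_restrict s]
  exact (G.even_length hs.2.1).add (H.even_length hs.2.2)

theorem alternating_append_singleton {M : Type*} {D : GameData M} {s : List M} {m : M}
    (h : D.Alternating s) (hm : (D.label m).1 = Polarity.O ↔ Even s.length) :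
    D.Alternating (s ++ [m]) := by
  rw [GameData.alternating_iff] at h ⊢
  intro p n hp
  rw [List.prefix_concat_iff] at hp
  rcases hp with hp | hp
  · obtain ⟨rfl, hn⟩ := List.append_inj' hp rfl
    obtain rfl : n = m := by simpa using hn
    exact hm
  · exact h p n hp

theorem alternating_append_map_inl {s : List (A ⊕ B)} {p : List A} (h : (GH).Alternating s)
    (hodd : Odd (restrictRight s).length) (hp : restrictLeft s ++ p ∈ Pref G.maxPos) :
    (GH).Alternating (s ++ p.map Sum.inl) := by
  induction p generalizing s with
  | nil => simpa using h
  | cons a p ih =>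
    have h1 := G.alternating_step (m := a) (s := restrictLeft s) (Pref.of_prefix hp ⟨p, by simp⟩)
    have := @ih (s ++ [Sum.inl a]) (alternating_append_singleton h ?_) (by simpa using hodd)
      (by simpa using hp)
    · simpa using this
    · rw [length_eq_restrict s]
      simp only [limp, limpLabel, Polarity.flip_eq_O_iff, h1]
      grind

theorem alternating_append_map_inr {s : List (A ⊕ B)} {q : List B} (h : (GH).Alternating s)
    (heven : Even (restrictLeft s).length) (hq : restrictRight s ++ q ∈ Pref H.maxPos) :
    (GH).Alternating (s ++ q.map Sum.inr) := by
  induction q generalizing s with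
  | nil => simpa using h
  | cons b q ih =>
    have h1 := H.alternating_step (m := b) (s := restrictRight s) (Pref.of_prefix hq ⟨q, by simp⟩)
    have := @ih (s ++ [Sum.inr b]) (alternating_append_singleton h ?_) (by simpa using heven)
      (by simpa using hq)
    · simpa using this
    · rw [length_eq_restrict s]
      simp only [limp, limpLabel, h1]
      grind

/-- While the right length is odd, the left component may be played to its end in one block. Its
length is then even, which is what allows the right component to be finished in a second block. -/
theorem mem_Pref_limp_of_odd_right {s : List (A ⊕ B)} (halt : (GH).Alternating s)
    (hl : restrictLeft s ∈ Pref G.maxPos) (hr : restrictRight s ∈ Pref H.maxPos)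
    (hodd : Odd (restrictRight s).length) : s ∈ Pref (GH).maxPos := by
  obtain ⟨_, hp, p, rfl⟩ := hl
  obtain ⟨_, hq, q, rfl⟩ := hr
  refine ⟨s ++ p.map Sum.inl ++ q.map Sum.inr, ⟨?_, by simpa using hp, by simpa using hq⟩,
    by simp⟩
  exact alternating_append_map_inr (alternating_append_map_inl halt hodd (subset_Pref _ hp))
    (by simpa using G.even_length hp) (by simpa using subset_Pref _ hq)

theorem Pref.limp_alternating {s : List (A ⊕ B)} (h : s ∈ Pref (GH).maxPos) :
    (GH).Alternating s := by
  obtain ⟨t, ht, hst⟩ := h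
  rw [GameData.alternating_iff]
  exact fun p m hp => ((GH).alternating_iff t).1 (QGames.limp_alternating ht) p m (hp.trans hst)

theorem Pref.append_inl {s : List (A ⊕ B)} {a : A} (h : s ∈ Pref (GH).maxPos)
    (hodd : Odd (restrictRight s).length) (ha : restrictLeft s ++ [a] ∈ Pref G.maxPos) :
    s ++ [Sum.inl a] ∈ Pref (GH).maxPos := by
  have h1 := G.alternating_step ha
  refine mem_Pref_limp_of_odd_right (alternating_append_singleton (Pref.limp_alternating h) ?_)
    (by simpa using ha) (by simpa using Pref.restrictRight_mem h) (by simpa using hodd)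
  rw [length_eq_restrict s]
  simp only [limp, limpLabel, Polarity.flip_eq_O_iff, h1]
  grind

theorem Pref.append_inr {s : List (A ⊕ B)} {b : B} (h : s ∈ Pref (GH).maxPos)
    (hl : Even (restrictLeft s).length) (hr : Even (restrictRight s).length)
    (hb : restrictRight s ++ [b] ∈ Pref H.maxPos) :
    s ++ [Sum.inr b] ∈ Pref (GH).maxPos := by
  have h1 := H.alternating_step hb
  refine mem_Pref_limp_of_odd_right (alternating_append_singleton (Pref.limp_alternating h) ?_)
    (by simpa using Pref.restrictLeft_mem h) (by simpa using hb) (by simpa using hr.add_one)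
  rw [length_eq_restrict s]
  simp only [limp, limpLabel, h1]
  grind

/-- No move can follow: on the right by maximality, on the left because the right length is even. -/
theorem mem_maxPos_of_right_mem {s : List (A ⊕ B)} (h : s ∈ Pref (GH).maxPos)
    (hr : restrictRight s ∈ H.maxPos) :
    s ∈ (GH).maxPos := by
  have he := H.even_length hr
  have h' := h
  obtain ⟨t, ht, hst⟩ := h'
  by_cases hne : s = t
  · rwa [hne]
  obtain ⟨m, hm⟩ := exists_append_singleton_prefix hst hne
  have hm' : s ++ [m] ∈ Pref (GH).maxPos := ⟨t, ht, hm⟩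
  cases m with
  | inl a => have := odd_right_of_left_move hm'; grind
  | inr b =>
    have h1 := restrictRight_prefix hm
    rw [← H.isGame.maximal _ hr _ ht.2.2 (restrictRight_prefix hst)] at h1
    have := h1.length_le
    simp at this

/-- Equally labelled answers from different components are coherent, so incoherence is always local
to one component. This lets it be handed from one strategy to the other. -/
theorem not_limpCoh_cases {p : Polarity} {m n : A ⊕ B} (hm : (GH).IsAnswerOf p m)
    (hn : (GH).IsAnswerOf p n) (h : ¬ (GH).coh m n) :
    (∃ a a', m = Sum.inl a ∧ n = Sum.inl a' ∧ ¬ G.coh a a') ∨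
      ∃ b b', m = Sum.inr b ∧ n = Sum.inr b' ∧ ¬ H.coh b b' := by
  have hm1 : limpLabel G.toGameData H.toGameData m = (p, Kind.A) := hm
  have hn1 : limpLabel G.toGameData H.toGameData n = (p, Kind.A) := hn
  cases m <;> cases n <;> simp_all [limp, limpCoh]

end Implication

/-! ### Consequences of the strategy axioms. -/

section Strategy

variable {M : Type*} {D : GameData M} {σ : List M → ℂ}

theorem GameData.IsStrategy.Pref_subset (hσ : D.IsStrategy σ) :
    Pref (Function.support σ) ⊆ Pref D.maxPos := Pref.mono hσ.mem_space

theorem GameData.IsStrategy.opponent_move (hσ : D.IsStrategy σ) {s : List M} {m : M}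
    (hs : s ∈ Pref (Function.support σ)) (he : Even s.length) (hm : s ++ [m] ∈ Pref D.maxPos) :
    s ++ [m] ∈ Pref (Function.support σ) := by
  obtain ⟨n, hn, -⟩ := hσ.determinacy s hs he m hm
  exact Pref.of_prefix hn ⟨[n], by simp⟩

theorem GameData.IsStrategy.player_move_unique (hσ : D.IsStrategy σ) {s : List M} {m n : M}
    (ho : Odd s.length) (hm : s ++ [m] ∈ Pref (Function.support σ))
    (hn : s ++ [n] ∈ Pref (Function.support σ)) : m = n := by
  rcases List.eq_nil_or_concat s with rfl | ⟨s, k, rfl⟩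
  · simp at ho
  rw [List.concat_eq_append] at *
  have hk := Pref.of_append_singleton hm
  refine (hσ.determinacy s (Pref.of_append_singleton hk) ?_ k (hσ.Pref_subset hk)).unique
    (by simpa using hm) (by simpa using hn)
  simp at ho
  grind

theorem GameData.IsStrategy.answer_mem (hσ : D.IsStrategy σ) {t : List M}
    (ht : t ∈ Function.support σ) {s : List M} {m : M} (ho : Odd s.length)
    (hm : s ++ [m] ∈ Pref (Function.support σ)) (hs : ∀ x ∈ s, D.IsAnswer x → x ∈ t)
    (ha : D.IsAnswer m) : m ∈ t :=
  (hσ.monotonicity t ht s m ho hm (fun x hx => ⟨hs x hx.1 hx.2, hx.2⟩)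
    (show m ∈ D.ans (s ++ [m]) from ⟨by simp, ha⟩)).1

end Strategy

/-! ### Interaction sequences and their restrictions. -/

section Interaction

variable {A B C : Type*}

/-- The inclusion of the moves of the first two components. -/
def embed12 : A ⊕ B → A ⊕ B ⊕ C := Sum.map id Sum.inl

@[simp] theorem embed12_inl (a : A) : embed12 (C := C) (Sum.inl a : A ⊕ B) = Sum.inl a := rfl

@[simp] theorem embed12_inr (b : B) :
    embed12 (C := C) (Sum.inr b : A ⊕ B) = Sum.inr (Sum.inl b) := rfl

@[simp] theorem restrict12_nil : restrict12 ([] : List (A ⊕ B ⊕ C)) = [] := rfl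

@[simp] theorem restrict23_nil : restrict23 ([] : List (A ⊕ B ⊕ C)) = [] := rfl

@[simp] theorem restrict13_nil : restrict13 ([] : List (A ⊕ B ⊕ C)) = [] := rfl

@[simp] theorem restrict12_append (u v : List (A ⊕ B ⊕ C)) :
    restrict12 (u ++ v) = restrict12 u ++ restrict12 v := List.filterMap_append

@[simp] theorem restrict23_append (u v : List (A ⊕ B ⊕ C)) :
    restrict23 (u ++ v) = restrict23 u ++ restrict23 v := List.filterMap_append

@[simp] theorem restrict13_append (u v : List (A ⊕ B ⊕ C)) :
    restrict13 (u ++ v) = restrict13 u ++ restrict13 v := List.filterMap_append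

@[simp] theorem restrict12_inl (a : A) :
    restrict12 [(Sum.inl a : A ⊕ B ⊕ C)] = [Sum.inl a] := rfl

@[simp] theorem restrict12_mid (b : B) :
    restrict12 [(Sum.inr (Sum.inl b) : A ⊕ B ⊕ C)] = [Sum.inr b] := rfl

@[simp] theorem restrict12_inr (c : C) :
    restrict12 [(Sum.inr (Sum.inr c) : A ⊕ B ⊕ C)] = [] := rfl

@[simp] theorem restrict23_inl (a : A) : restrict23 [(Sum.inl a : A ⊕ B ⊕ C)] = [] := rfl

@[simp] theorem restrict23_inr (x : B ⊕ C) :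
    restrict23 [(Sum.inr x : A ⊕ B ⊕ C)] = [x] := rfl

@[simp] theorem restrict13_inl (a : A) :
    restrict13 [(Sum.inl a : A ⊕ B ⊕ C)] = [Sum.inl a] := rfl

@[simp] theorem restrict13_mid (b : B) :
    restrict13 [(Sum.inr (Sum.inl b) : A ⊕ B ⊕ C)] = [] := rfl

@[simp] theorem restrict13_inr (c : C) :
    restrict13 [(Sum.inr (Sum.inr c) : A ⊕ B ⊕ C)] = [Sum.inr c] := rfl

theorem restrict12_prefix {u v : List (A ⊕ B ⊕ C)} (h : u <+: v) :
    restrict12 u <+: restrict12 v := h.filterMap _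

theorem restrict23_prefix {u v : List (A ⊕ B ⊕ C)} (h : u <+: v) :
    restrict23 u <+: restrict23 v := h.filterMap _

theorem restrict13_prefix {u v : List (A ⊕ B ⊕ C)} (h : u <+: v) :
    restrict13 u <+: restrict13 v := h.filterMap _

theorem restrictLeft_restrict13 (u : List (A ⊕ B ⊕ C)) :
    restrictLeft (restrict13 u) = restrictLeft (restrict12 u) := by
  induction u using List.reverseRecOn with
  | nil => rfl
  | append_singleton u x ih => rcases x with a | b | c <;> simp [ih]

theorem restrictRight_restrict13 (u : List (A ⊕ B ⊕ C)) :
    restrictRight (restrict13 u) = restrictRight (restrict23 u) := by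
  induction u using List.reverseRecOn with
  | nil => rfl
  | append_singleton u x ih => rcases x with a | b | c <;> simp [ih]

theorem restrictLeft_restrict23 (u : List (A ⊕ B ⊕ C)) :
    restrictLeft (restrict23 u) = restrictRight (restrict12 u) := by
  induction u using List.reverseRecOn with
  | nil => rfl
  | append_singleton u x ih => rcases x with a | b | c <;> simp [ih]

theorem length_eq_restrict12_restrict23 (u : List (A ⊕ B ⊕ C)) :
    u.length = (restrictLeft (restrict12 u)).length + (restrict23 u).length := by
  induction u using List.reverseRecOn with
  | nil => rfl
  | append_singleton u x ih => rcases x with a | b | c <;> simp [ih] <;> omega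

theorem mem_restrict12 {u : List (A ⊕ B ⊕ C)} {x : A ⊕ B} :
    x ∈ restrict12 u ↔ embed12 x ∈ u := by
  induction u using List.reverseRecOn with
  | nil => simp
  | append_singleton u y ih => rcases y with a | b | c <;> rcases x with a | b <;> simp_all

theorem mem_restrict23 {u : List (A ⊕ B ⊕ C)} {x : B ⊕ C} :
    x ∈ restrict23 u ↔ Sum.inr x ∈ u := by
  induction u using List.reverseRecOn with
  | nil => simp
  | append_singleton u y ih => rcases y with a | b | c <;> rcases x with a | b <;> simp_all

theorem inl_mem_restrict13 {u : List (A ⊕ B ⊕ C)} {a : A} :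
    Sum.inl a ∈ restrict13 u ↔ Sum.inl a ∈ u := by
  rw [← mem_restrictLeft, restrictLeft_restrict13, mem_restrictLeft, mem_restrict12]
  rfl

theorem inr_mem_restrict13 {u : List (A ⊕ B ⊕ C)} {c : C} :
    Sum.inr c ∈ restrict13 u ↔ Sum.inr (Sum.inr c) ∈ u := by
  rw [← mem_restrictRight, restrictRight_restrict13, mem_restrictRight, mem_restrict23]

/-- The interaction is cut just before the move that restricts to `m`; moves outside the restriction
that precede it stay in `w`. -/
theorem exists_prefix_of_restrict12 {u : List (A ⊕ B ⊕ C)} {s : List (A ⊕ B)} {m : A ⊕ B}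
    (h : s ++ [m] <+: restrict12 u) : ∃ w, w ++ [embed12 m] <+: u ∧ restrict12 w = s := by
  obtain ⟨w, x, hw, hs, hx⟩ := prefix_filterMap_append_singleton h
  refine ⟨w, ?_, hs⟩
  rcases x with a | b | c <;> simp at hx <;> subst hx <;> exact hw

theorem exists_prefix_of_restrict23 {u : List (A ⊕ B ⊕ C)} {s : List (B ⊕ C)} {m : B ⊕ C}
    (h : s ++ [m] <+: restrict23 u) : ∃ w, w ++ [Sum.inr m] <+: u ∧ restrict23 w = s := by
  obtain ⟨w, x, hw, hs, hx⟩ := prefix_filterMap_append_singleton h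
  refine ⟨w, ?_, hs⟩
  rcases x with a | b | c <;> simp at hx <;> subst hx <;> exact hw

theorem exists_prefix_of_restrict13 {u : List (A ⊕ B ⊕ C)} {s : List (A ⊕ C)} {m : A ⊕ C}
    (h : s ++ [m] <+: restrict13 u) :
    ∃ w, w ++ [Sum.map id Sum.inr m] <+: u ∧ restrict13 w = s := by
  obtain ⟨w, x, hw, hs, hx⟩ := prefix_filterMap_append_singleton h
  refine ⟨w, ?_, hs⟩
  rcases x with a | b | c <;> simp at hx <;> subst hx <;> exact hw

variable {σ : List (A ⊕ B) → ℂ} {τ : List (B ⊕ C) → ℂ}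

/-- `u` is compatible with the strategies `σ` and `τ`: its restrictions are prefixes of plays. -/
def Compatible (σ : List (A ⊕ B) → ℂ) (τ : List (B ⊕ C) → ℂ) (u : List (A ⊕ B ⊕ C)) : Prop :=
  restrict12 u ∈ Pref (Function.support σ) ∧ restrict23 u ∈ Pref (Function.support τ)

theorem Compatible.of_prefix {u v : List (A ⊕ B ⊕ C)} (h : Compatible σ τ v) (huv : u <+: v) :
    Compatible σ τ u :=
  ⟨Pref.of_prefix h.1 (restrict12_prefix huv), Pref.of_prefix h.2 (restrict23_prefix huv)⟩

theorem par_ne_zero_iff {u : List (A ⊕ B ⊕ C)} : par σ τ u ≠ 0 ↔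
    restrict12 u ∈ Function.support σ ∧ restrict23 u ∈ Function.support τ := by
  simp [par]

theorem compatible_of_par_ne_zero {u : List (A ⊕ B ⊕ C)} (h : par σ τ u ≠ 0) :
    Compatible σ τ u :=
  ⟨subset_Pref _ (par_ne_zero_iff.1 h).1, subset_Pref _ (par_ne_zero_iff.1 h).2⟩

variable {G : Game A} {H : Game B} {K : Game C}

local notation "GH" => limp (Game.toGameData G) (Game.toGameData H)
local notation "HK" => limp (Game.toGameData H) (Game.toGameData K)
local notation "GK" => limp (Game.toGameData G) (Game.toGameData K)

/-! ### Parity states, absence of deadlock and uniqueness of interactions. -/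

theorem Compatible.odd_mid_of_left_move (hσ : (GH).IsStrategy σ) {u : List (A ⊕ B ⊕ C)} {a : A}
    (h : Compatible σ τ (u ++ [Sum.inl a])) : Odd (restrictRight (restrict12 u)).length :=
  odd_right_of_left_move (a := a) (by simpa using hσ.Pref_subset h.1)

theorem Compatible.even_left_of_mid_move (hσ : (GH).IsStrategy σ) {u : List (A ⊕ B ⊕ C)} {b : B}
    (h : Compatible σ τ (u ++ [Sum.inr (Sum.inl b)])) :
    Even (restrictLeft (restrict12 u)).length :=
  even_left_of_right_move (b := b) (by simpa using hσ.Pref_subset h.1)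

theorem Compatible.odd_right_of_mid_move (hτ : (HK).IsStrategy τ) {u : List (A ⊕ B ⊕ C)} {b : B}
    (h : Compatible σ τ (u ++ [Sum.inr (Sum.inl b)])) :
    Odd (restrictRight (restrict23 u)).length :=
  QGames.odd_right_of_left_move (a := b) (by simpa using hτ.Pref_subset h.2)

theorem Compatible.even_mid_of_right_move (hτ : (HK).IsStrategy τ) {u : List (A ⊕ B ⊕ C)} {c : C}
    (h : Compatible σ τ (u ++ [Sum.inr (Sum.inr c)])) :
    Even (restrictRight (restrict12 u)).length := by
  rw [← restrictLeft_restrict23]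
  exact even_left_of_right_move (b := c) (by simpa using hτ.Pref_subset h.2)

theorem Compatible.odd_mid_of_odd_left (hσ : (GH).IsStrategy σ) {u : List (A ⊕ B ⊕ C)}
    (h : Compatible σ τ u) (ho : Odd (restrictLeft (restrict12 u)).length) :
    Odd (restrictRight (restrict12 u)).length :=
  odd_right_of_odd_left (hσ.Pref_subset h.1) ho

theorem Compatible.odd_right_of_odd_mid (hτ : (HK).IsStrategy τ) {u : List (A ⊕ B ⊕ C)}
    (h : Compatible σ τ u) (ho : Odd (restrictRight (restrict12 u)).length) :
    Odd (restrictRight (restrict23 u)).length :=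
  odd_right_of_odd_left (hτ.Pref_subset h.2) (by rwa [restrictLeft_restrict23])

theorem length_restrict13 (u : List (A ⊕ B ⊕ C)) : (restrict13 u).length =
    (restrictLeft (restrict12 u)).length + (restrictRight (restrict23 u)).length := by
  rw [length_eq_restrict, restrictLeft_restrict13, restrictRight_restrict13]

theorem length_restrict12 (u : List (A ⊕ B ⊕ C)) : (restrict12 u).length =
    (restrictLeft (restrict12 u)).length + (restrictRight (restrict12 u)).length :=
  length_eq_restrict _

theorem length_restrict23 (u : List (A ⊕ B ⊕ C)) : (restrict23 u).length =
    (restrictRight (restrict12 u)).length + (restrictRight (restrict23 u)).length := by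
  rw [length_eq_restrict, restrictLeft_restrict23]

theorem GameData.IsStrategy.exists_player_move (hσ : (GH).IsStrategy σ) {s : List (A ⊕ B)}
    (hs : s ∈ Pref (Function.support σ)) (ho : Odd s.length) :
    ∃ m, s ++ [m] ∈ Pref (Function.support σ) := by
  obtain ⟨t, ht, hst⟩ := hs
  have he := limp_even_length (hσ.mem_space ht)
  obtain ⟨m, hm⟩ := exists_append_singleton_prefix hst (by rintro rfl; grind)
  exact ⟨m, t, ht, hm⟩

theorem GameData.IsStrategy.mem_support_of_mem_maxPos (hσ : (GH).IsStrategy σ)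
    {s : List (A ⊕ B)} (hs : s ∈ Pref (Function.support σ)) (hmax : s ∈ (GH).maxPos) :
    s ∈ Function.support σ := by
  obtain ⟨t, ht, hst⟩ := hs
  rwa [limp_maximal hmax (hσ.mem_space ht) hst]

/-- A compatible sequence is a complete interaction, or it can be continued. -/
theorem Compatible.par_ne_zero_or_exists_move (hσ : (GH).IsStrategy σ) (hτ : (HK).IsStrategy τ)
    (Q : A ⊕ B ⊕ C → Prop)
    (hσQ : ∀ s m, Odd s.length → s ++ [m] ∈ Pref (Function.support σ) →
      (∀ x ∈ s, Q (embed12 x)) → Q (embed12 m))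
    (hτQ : ∀ s m, Odd s.length → s ++ [m] ∈ Pref (Function.support τ) →
      (∀ x ∈ s, Q (Sum.inr x)) → Q (Sum.inr m))
    (hG : ∀ p ∈ Pref G.maxPos, p ∉ G.maxPos → (∀ x ∈ p, Q (Sum.inl x)) →
      ∃ m, p ++ [m] ∈ Pref G.maxPos ∧ Q (Sum.inl m))
    (hK : ∀ p ∈ Pref K.maxPos, p ∉ K.maxPos → (∀ x ∈ p, Q (Sum.inr (Sum.inr x))) →
      ∃ m, p ++ [m] ∈ Pref K.maxPos ∧ Q (Sum.inr (Sum.inr m)))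
    {w : List (A ⊕ B ⊕ C)} (hw : Compatible σ τ w) (hQ : ∀ x ∈ w, Q x) :
    par σ τ w ≠ 0 ∨ ∃ x, Compatible σ τ (w ++ [x]) ∧ Q x := by
  have hab := hw.odd_mid_of_odd_left hσ
  have hbc := hw.odd_right_of_odd_mid hτ
  have l12 := length_restrict12 w
  have l23 := length_restrict23 w
  have m12 := hσ.Pref_subset hw.1
  have m23 := hτ.Pref_subset hw.2
  -- `hab` and `hbc` leave four states. In the all-even state, maximality in K propagates to H and
  -- then to G, so the interaction is complete or Opponent can move in K. In the mixed states `τ` or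
  -- `σ` responds, and a response in H is accepted by the other strategy as an Opponent move.
  rcases Nat.even_or_odd (restrictLeft (restrict12 w)).length with ha | ha
  · rcases Nat.even_or_odd (restrictRight (restrict12 w)).length with hb | hb
    · rcases Nat.even_or_odd (restrictRight (restrict23 w)).length with hc | hc
      · by_cases hmax : restrictRight (restrict23 w) ∈ K.maxPos
        · left
          have h23 := mem_maxPos_of_right_mem m23 hmax
          have h12 := mem_maxPos_of_right_mem m12 (by
            rw [← restrictLeft_restrict23]; exact h23.2.1)
          exact par_ne_zero_iff.2 ⟨hσ.mem_support_of_mem_maxPos hw.1 h12,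
            hτ.mem_support_of_mem_maxPos hw.2 h23⟩
        · right
          obtain ⟨m, hm, hQm⟩ := hK _ (Pref.restrictRight_mem m23) hmax
            (fun x hx => hQ _ (mem_restrict23.1 (mem_restrictRight.1 hx)))
          refine ⟨_, ⟨by simpa using hw.1, ?_⟩, hQm⟩
          rw [restrict23_append, restrict23_inr]
          exact hτ.opponent_move hw.2 (by grind)
            (Pref.append_inr m23 (by rwa [restrictLeft_restrict23]) hc hm)
      · right
        have ho : Odd (restrict23 w).length := by grind
        obtain ⟨m, hm⟩ := hτ.exists_player_move hw.2 ho
        refine ⟨Sum.inr m, ⟨?_, by simpa using hm⟩,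
          hτQ _ m ho hm fun x hx => hQ _ (mem_restrict23.1 hx)⟩
        cases m with
        | inr c => simpa using hw.1
        | inl b =>
          rw [restrict12_append, restrict12_mid]
          refine hσ.opponent_move hw.1 (by grind) (Pref.append_inr m12 ha hb ?_)
          simpa [restrictLeft_restrict23] using Pref.restrictLeft_mem (hτ.Pref_subset hm)
    · right
      have ho : Odd (restrict12 w).length := by grind
      obtain ⟨m, hm⟩ := hσ.exists_player_move hw.1 ho
      have hQm := hσQ _ m ho hm fun x hx => hQ _ (mem_restrict12.1 hx)
      cases m with
      | inl a => exact ⟨Sum.inl a, ⟨by simpa using hm, by simpa using hw.2⟩, hQm⟩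
      | inr b =>
        refine ⟨Sum.inr (Sum.inl b), ⟨by simpa using hm, ?_⟩, hQm⟩
        rw [restrict23_append, restrict23_inr]
        refine hτ.opponent_move hw.2 (by grind) (Pref.append_inl m23 (hbc hb) ?_)
        simpa [restrictLeft_restrict23] using Pref.restrictRight_mem (hσ.Pref_subset hm)
  · right
    obtain ⟨m, hm, hQm⟩ := hG _ (Pref.restrictLeft_mem m12)
      -- A position of odd length is not maximal, so Opponent has a move left in G.
      (fun h => by have := G.even_length h; grind)
      (fun x hx => hQ _ (mem_restrict12.1 (mem_restrictLeft.1 hx)))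
    refine ⟨_, ⟨?_, by simpa using hw.2⟩, hQm⟩
    rw [restrict12_append, restrict12_inl]
    exact hσ.opponent_move hw.1 (by grind) (Pref.append_inl m12 (hab ha) hm)

theorem Compatible.exists_length_bound (hσ : (GH).IsStrategy σ) (hτ : (HK).IsStrategy τ) :
    ∃ N, ∀ w, Compatible σ τ w → w.length ≤ N := by
  obtain ⟨N₁, h₁⟩ := exists_length_bound_of_finite G.isGame.finite
  obtain ⟨N₂, h₂⟩ := exists_length_bound_of_finite H.isGame.finite
  obtain ⟨N₃, h₃⟩ := exists_length_bound_of_finite K.isGame.finite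
  refine ⟨N₁ + (N₂ + N₃), fun w hw => ?_⟩
  rw [length_eq_restrict12_restrict23, length_restrict23]
  exact add_le_add (h₁ _ (Pref.restrictLeft_mem (hσ.Pref_subset hw.1)))
    (add_le_add (h₂ _ (Pref.restrictRight_mem (hσ.Pref_subset hw.1)))
      (h₃ _ (Pref.restrictRight_mem (hτ.Pref_subset hw.2))))

/-- There is no deadlock: every compatible sequence extends to a complete interaction, and the
extension stays within every set of moves that both strategies respect and in which Opponent can
always play. -/
theorem Compatible.exists_extension (hσ : (GH).IsStrategy σ) (hτ : (HK).IsStrategy τ)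
    (Q : A ⊕ B ⊕ C → Prop)
    (hσQ : ∀ s m, Odd s.length → s ++ [m] ∈ Pref (Function.support σ) →
      (∀ x ∈ s, Q (embed12 x)) → Q (embed12 m))
    (hτQ : ∀ s m, Odd s.length → s ++ [m] ∈ Pref (Function.support τ) →
      (∀ x ∈ s, Q (Sum.inr x)) → Q (Sum.inr m))
    (hG : ∀ p ∈ Pref G.maxPos, p ∉ G.maxPos → (∀ x ∈ p, Q (Sum.inl x)) →
      ∃ m, p ++ [m] ∈ Pref G.maxPos ∧ Q (Sum.inl m))
    (hK : ∀ p ∈ Pref K.maxPos, p ∉ K.maxPos → (∀ x ∈ p, Q (Sum.inr (Sum.inr x))) →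
      ∃ m, p ++ [m] ∈ Pref K.maxPos ∧ Q (Sum.inr (Sum.inr m)))
    {w : List (A ⊕ B ⊕ C)} (hw : Compatible σ τ w) (hQ : ∀ x ∈ w, Q x) :
    ∃ u, w <+: u ∧ par σ τ u ≠ 0 ∧ ∀ x ∈ u, Q x := by
  obtain ⟨N, hN⟩ := Compatible.exists_length_bound hσ hτ
  -- Each new move uses up room below the length bound; the `+ 1` makes the base case contradict the
  -- bound.
  induction hk : N + 1 - w.length generalizing w with
  | zero => have := hN w hw; omega
  | succ k ih =>
    rcases hw.par_ne_zero_or_exists_move hσ hτ Q hσQ hτQ hG hK hQ with h | ⟨x, hx, hQx⟩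
    · exact ⟨w, List.prefix_rfl, h, hQ⟩
    · obtain ⟨u, hu, h⟩ := ih hx (List.forall_mem_append.2 ⟨hQ, List.forall_mem_singleton.2 hQx⟩)
        (by simp only [List.length_append, List.length_singleton]; omega)
      exact ⟨u, prefix_of_append_singleton_prefix hu, h⟩

theorem exists_move_of_not_mem_maxPos {M : Type*} {S : Set (List M)} {p : List M}
    (hp : p ∈ Pref S) (h : p ∉ S) : ∃ m, p ++ [m] ∈ Pref S := by
  obtain ⟨t, ht, hpt⟩ := hp
  obtain ⟨m, hm⟩ := exists_append_singleton_prefix hpt (by rintro rfl; exact h ht)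
  exact ⟨m, t, ht, hm⟩

theorem Compatible.exists_par_ne_zero (hσ : (GH).IsStrategy σ) (hτ : (HK).IsStrategy τ)
    {w : List (A ⊕ B ⊕ C)} (hw : Compatible σ τ w) : ∃ u, w <+: u ∧ par σ τ u ≠ 0 := by
  obtain ⟨u, h1, h2, -⟩ := hw.exists_extension hσ hτ (fun _ => True) (by simp) (by simp)
    (fun p hp h _ => by simpa using exists_move_of_not_mem_maxPos hp h)
    (fun p hp h _ => by simpa using exists_move_of_not_mem_maxPos hp h) (by simp)
  exact ⟨u, h1, h2⟩

/-- A set of moves that both strategies respect and that contains the visible Opponent moves of a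
compatible sequence contains all its moves. -/
theorem Compatible.forall_mem_of_opponent_moves (hσ : (GH).IsStrategy σ)
    (hτ : (HK).IsStrategy τ) (Q : A ⊕ B ⊕ C → Prop)
    (hσQ : ∀ s m, Odd s.length → s ++ [m] ∈ Pref (Function.support σ) →
      (∀ x ∈ s, Q (embed12 x)) → Q (embed12 m))
    (hτQ : ∀ s m, Odd s.length → s ++ [m] ∈ Pref (Function.support τ) →
      (∀ x ∈ s, Q (Sum.inr x)) → Q (Sum.inr m))
    {w : List (A ⊕ B ⊕ C)} (hw : Compatible σ τ w)
    (hA : ∀ p a, p ++ [Sum.inl a] <+: w → Odd (restrictLeft (restrict12 p)).length →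
      Q (Sum.inl a))
    (hC : ∀ p c, p ++ [Sum.inr (Sum.inr c)] <+: w →
      Even (restrictRight (restrict23 p)).length → Q (Sum.inr (Sum.inr c))) :
    ∀ x ∈ w, Q x := by
  induction w using List.reverseRecOn with
  | nil => simp
  | append_singleton w x ih =>
    have hpre : w <+: w ++ [x] := List.prefix_append _ _
    have hw' := hw.of_prefix hpre
    have hQ := ih hw' (fun p a hp => hA p a (hp.trans hpre))
      (fun p c hp => hC p c (hp.trans hpre))
    have hab := hw'.odd_mid_of_odd_left hσ
    have hbc := hw'.odd_right_of_odd_mid hτ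
    have l12 := length_restrict12 w
    have l23 := length_restrict23 w
    suffices Q x from List.forall_mem_append.2 ⟨hQ, List.forall_mem_singleton.2 this⟩
    have key12 : ∀ m, x = embed12 m → Odd (restrict12 w).length → Q x := by
      rintro m rfl ho
      refine hσQ _ m ho ?_ fun y hy => hQ _ (mem_restrict12.1 hy)
      rcases m with a | b <;> simpa using hw.1
    have key23 : ∀ m, x = Sum.inr m → Odd (restrict23 w).length → Q x := by
      rintro m rfl ho
      exact hτQ _ m ho (by simpa using hw.2) fun y hy => hQ _ (mem_restrict23.1 hy)
    rcases x with a | b | c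
    · have h := hw.odd_mid_of_left_move hσ
      rcases Nat.even_or_odd (restrictLeft (restrict12 w)).length with ha | ha
      · exact key12 (Sum.inl a) rfl (by grind)
      · exact hA w a List.prefix_rfl ha
    · have h1 := hw.even_left_of_mid_move hσ
      have h2 := hw.odd_right_of_mid_move hτ
      rcases Nat.even_or_odd (restrictRight (restrict12 w)).length with hb | hb
      · exact key23 (Sum.inl b) rfl (by grind)
      · exact key12 (Sum.inr b) rfl (by grind)
    · have h := hw.even_mid_of_right_move hτ
      rcases Nat.even_or_odd (restrictRight (restrict23 w)).length with hc | hc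
      · exact hC w c List.prefix_rfl hc
      · exact key23 (Sum.inr c) rfl (by grind)

/-- Two different complete interactions part at an Opponent move in an outer component. -/
theorem exists_opponent_divergence (hσ : (GH).IsStrategy σ) (hτ : (HK).IsStrategy τ)
    {u v : List (A ⊕ B ⊕ C)} (hu : par σ τ u ≠ 0) (hv : par σ τ v ≠ 0) (hne : u ≠ v) :
    ∃ s m n, m ≠ n ∧ s ++ [m] <+: restrict13 u ∧ s ++ [n] <+: restrict13 v ∧
      Even s.length := by
  have hmax : ∀ {u v}, par σ τ u ≠ 0 → par σ τ v ≠ 0 → u <+: v → u = v := by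
    intro u v hu hv h
    refine h.eq_of_length ?_
    have h12 := limp_maximal (hσ.mem_space (par_ne_zero_iff.1 hu).1)
      (hσ.mem_space (par_ne_zero_iff.1 hv).1) (restrict12_prefix h)
    have h23 := limp_maximal (hτ.mem_space (par_ne_zero_iff.1 hu).2)
      (hτ.mem_space (par_ne_zero_iff.1 hv).2) (restrict23_prefix h)
    rw [length_eq_restrict12_restrict23, length_eq_restrict12_restrict23 v, h12, h23]
  rcases prefix_or_prefix_or_diverge u v with h | h | ⟨w, x, y, hxy, hx, hy⟩
  · exact absurd (hmax hu hv h) hne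
  · exact absurd (hmax hv hu h).symm hne
  have cx := (compatible_of_par_ne_zero hu).of_prefix hx
  have cy := (compatible_of_par_ne_zero hv).of_prefix hy
  have cw := cx.of_prefix (List.prefix_append _ _)
  have hab := cw.odd_mid_of_odd_left hσ
  have hbc := cw.odd_right_of_odd_mid hτ
  have l12 := length_restrict12 w
  have l23 := length_restrict23 w
  have l13 := length_restrict13 w
  have px := restrict13_prefix hx
  have py := restrict13_prefix hy
  -- Where `σ` is to move, its response is unique, so both diverging moves cannot belong to its
  -- game; `key23` is the same for `τ`.
  have key12 : ∀ m n, x = embed12 m → y = embed12 n → ¬ Odd (restrict12 w).length := by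
    rintro m n rfl rfl ho
    refine hxy (congrArg _ (hσ.player_move_unique ho (m := m) (n := n) ?_ ?_))
    · rcases m with a | b <;> simpa using cx.1
    · rcases n with a | b <;> simpa using cy.1
  have key23 : ∀ m n, x = Sum.inr m → y = Sum.inr n → ¬ Odd (restrict23 w).length := by
    rintro m n rfl rfl ho
    exact hxy (congrArg _ (hτ.player_move_unique ho (by simpa using cx.2) (by simpa using cy.2)))
  -- Each kind of next move constrains the common state at `w`. Two moves of different kinds, or two
  -- moves in H, then contradict each other or put one of the strategies on move; only two Opponent
  -- moves in G or two in K survive.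
  have parity : ∀ z, Compatible σ τ (w ++ [z]) →
      (∃ a, z = Sum.inl a ∧ Odd (restrictRight (restrict12 w)).length) ∨
      (∃ b, z = Sum.inr (Sum.inl b) ∧ Even (restrictLeft (restrict12 w)).length ∧
        Odd (restrictRight (restrict23 w)).length) ∨
      ∃ c, z = Sum.inr (Sum.inr c) ∧ Even (restrictRight (restrict12 w)).length := by
    intro z hz
    rcases z with a | b | c
    · exact Or.inl ⟨a, rfl, hz.odd_mid_of_left_move hσ⟩
    · exact Or.inr (Or.inl ⟨b, rfl, hz.even_left_of_mid_move hσ, hz.odd_right_of_mid_move hτ⟩)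
    · exact Or.inr (Or.inr ⟨c, rfl, hz.even_mid_of_right_move hτ⟩)
  rcases parity x cx with ⟨a, rfl, h1⟩ | ⟨b, rfl, h1, h2⟩ | ⟨c, rfl, h1⟩ <;>
    rcases parity y cy with ⟨a', rfl, h3⟩ | ⟨b', rfl, h3, h4⟩ | ⟨c', rfl, h3⟩
  · have := key12 (Sum.inl a) (Sum.inl a') rfl rfl
    exact ⟨restrict13 w, Sum.inl a, Sum.inl a', by simpa using hxy, by simpa using px,
      by simpa using py, by grind⟩
  · have := key12 (Sum.inl a) (Sum.inr b') rfl rfl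
    grind
  · grind
  · have := key12 (Sum.inr b) (Sum.inl a') rfl rfl
    grind
  · have := key12 (Sum.inr b) (Sum.inr b') rfl rfl
    have := key23 (Sum.inl b) (Sum.inl b') rfl rfl
    grind
  · have := key23 (Sum.inl b) (Sum.inr c') rfl rfl
    grind
  · grind
  · have := key23 (Sum.inr c) (Sum.inl b') rfl rfl
    grind
  · have := key23 (Sum.inr c) (Sum.inr c') rfl rfl
    exact ⟨restrict13 w, Sum.inr c, Sum.inr c', by simpa using hxy, by simpa using px,
      by simpa using py, by grind⟩

theorem eq_of_restrict13_eq (hσ : (GH).IsStrategy σ) (hτ : (HK).IsStrategy τ)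
    {u v : List (A ⊕ B ⊕ C)} (hu : par σ τ u ≠ 0) (hv : par σ τ v ≠ 0)
    (h : restrict13 u = restrict13 v) : u = v := by
  by_contra hne
  obtain ⟨s, m, n, hmn, h1, h2, -⟩ := exists_opponent_divergence hσ hτ hu hv hne
  rw [h] at h1
  exact hmn (append_singleton_prefix_unique h1 h2)

theorem comp_restrict13 (hσ : (GH).IsStrategy σ) (hτ : (HK).IsStrategy τ)
    {u : List (A ⊕ B ⊕ C)} (hu : par σ τ u ≠ 0) : comp σ τ (restrict13 u) = par σ τ u := by
  -- Restriction to the outer components is injective on complete interactions, so only `u`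
  -- contributes to the sum.
  rw [comp, ← finsum_mem_singleton (a := u) (f := par σ τ)]
  refine finsum_mem_inter_support_eq _ _ _ ?_
  ext v
  simp only [Set.mem_inter_iff, Set.mem_ofPred_eq, Function.mem_support, Set.mem_singleton_iff]
  constructor
  · rintro ⟨h, hv⟩
    exact ⟨eq_of_restrict13_eq hσ hτ hv hu h, hv⟩
  · rintro ⟨rfl, hv⟩
    exact ⟨rfl, hv⟩

theorem mem_support_comp_iff (hσ : (GH).IsStrategy σ) (hτ : (HK).IsStrategy τ)
    {s : List (A ⊕ C)} :
    s ∈ Function.support (comp σ τ) ↔ ∃ u, par σ τ u ≠ 0 ∧ restrict13 u = s := by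
  constructor
  · intro h
    obtain ⟨u, hu, hne⟩ := exists_ne_zero_of_finsum_mem_ne_zero h
    exact ⟨u, hne, hu⟩
  · rintro ⟨u, hu, rfl⟩
    rwa [Function.mem_support, comp_restrict13 hσ hτ hu]

end Interaction

/-! ### Answer sets, maximal cliques and the extension axiom. -/

section Answers

variable {M : Type*}

theorem GameData.ansOf_eq_of_ans_eq {D : GameData M} {s t : List M} (h : D.ans s = D.ans t)
    (p : Polarity) : D.ansOf p s = D.ansOf p t := by
  have key : ∀ l, D.ansOf p l = {m | m ∈ D.ans l ∧ D.IsAnswerOf p m} := by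
    intro l
    ext m
    simp only [ansOf, ans, IsAnswer, IsAnswerOf, Set.mem_ofPred_eq]
    constructor
    · rintro ⟨h1, h2⟩
      exact ⟨⟨h1, by rw [h2]⟩, h2⟩
    · rintro ⟨⟨h1, -⟩, h2⟩
      exact ⟨h1, h2⟩
  rw [key, key, h]

theorem GameData.ans_eq_of_ansOf_eq {D : GameData M} {s t : List M}
    (hO : D.ansOf Polarity.O s = D.ansOf Polarity.O t)
    (hP : D.ansOf Polarity.P s = D.ansOf Polarity.P t) : D.ans s = D.ans t := by
  have key : ∀ l, D.ans l = D.ansOf Polarity.O l ∪ D.ansOf Polarity.P l := by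
    intro l
    ext m
    simp only [ansOf, ans, IsAnswer, IsAnswerOf, Set.mem_ofPred_eq, Set.mem_union]
    rcases D.label m with ⟨p, k⟩
    cases p <;> simp
  rw [key, key, hO, hP]

/-- The answers of `s` form a union of two maximal cliques; the extension axiom completes `p` inside
that union, and the next move of the completion serves. -/
theorem GameData.exists_move_within {D : GameData M} (hD : D.IsGame) {s p : List M}
    (hs : s ∈ D.maxPos) (hp : p ∈ Pref D.maxPos) (hpm : p ∉ D.maxPos)
    (h : ∀ x ∈ p, D.IsAnswer x → x ∈ s) :
    ∃ m, p ++ [m] ∈ Pref D.maxPos ∧ (D.IsAnswer m → m ∈ s) := by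
  obtain ⟨v, w, hv, hw, hvw⟩ := hD.completeness s hs
  obtain ⟨t, ht, hpt, htans⟩ := hD.extension p hp v w hv hw
    (by rw [← hvw]; exact fun x hx => ⟨h x hx.1 hx.2, hx.2⟩)
  obtain ⟨m, hm⟩ := exists_append_singleton_prefix hpt (by rintro rfl; exact hpm ht)
  refine ⟨m, ⟨t, ht, hm⟩, fun ha => ?_⟩
  have : m ∈ D.ans t := ⟨mem_of_append_singleton_prefix hm, ha⟩
  rw [htans, ← hvw] at this
  exact this.1

/-- Polarity separates the two cliques, so the inclusion holds between cliques of the same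
protagonist, where maximality turns it into equality. -/
theorem GameData.ans_eq_of_subset {D : GameData M} (hD : D.IsGame) {s t : List M}
    (hs : s ∈ D.maxPos) (ht : t ∈ D.maxPos) (h : D.ans s ⊆ D.ans t) : D.ans s = D.ans t := by
  obtain ⟨v, w, hv, hw, hvw⟩ := hD.completeness s hs
  obtain ⟨v', w', hv', hw', hvw'⟩ := hD.completeness t ht
  rw [hvw, hvw'] at h ⊢
  have key : ∀ p q x, p ≠ q → D.IsAnswerOf p x → ¬ D.IsAnswerOf q x := by
    intro p q x hpq h1 h2
    exact hpq (congrArg Prod.fst (h1.symm.trans h2))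
  rw [hv.eq_of_subset hv'.prop, hw.eq_of_subset hw'.prop]
  · intro x hx
    rcases h (Or.inr hx) with h' | h'
    · exact absurd (hw.prop.1 x hx) (key _ _ x (by simp) (hv'.prop.1 x h'))
    · exact h'
  · intro x hx
    rcases h (Or.inl hx) with h' | h'
    · exact h'
    · exact absurd (hv.prop.1 x hx) (key _ _ x (by simp) (hw'.prop.1 x h'))

theorem GameData.ExtEquiv.symm {D : GameData M} {σ τ : List M → ℂ} (h : D.ExtEquiv σ τ) :
    D.ExtEquiv τ σ := ⟨h.2.1, h.1, h.2.2.symm⟩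

theorem GameData.ScalarWellDefined.eq_of_ans_eq {D : GameData M} {σ : List M → ℂ}
    (h : D.ScalarWellDefined σ) {s t : List M} (hs : σ s ≠ 0) (ht : σ t ≠ 0)
    (hst : D.ans s = D.ans t) : σ s = σ t :=
  h s t hs ht (D.ansOf_eq_of_ans_eq hst _) (D.ansOf_eq_of_ans_eq hst _)

theorem GameData.ExtEquiv.exists_play {D : GameData M} {σ τ : List M → ℂ} (h : D.ExtEquiv σ τ)
    {s : List M} (hs : σ s ≠ 0) : ∃ t, τ t ≠ 0 ∧ τ t = σ s ∧ D.ans t = D.ans s := by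
  have : (D.ansOf Polarity.O s, σ s, D.ansOf Polarity.P s) ∈ D.fnGraph σ := ⟨s, hs, rfl⟩
  rw [h.2.2] at this
  obtain ⟨t, ht, heq⟩ := this
  simp only [Prod.mk.injEq] at heq
  exact ⟨t, ht, heq.2.1.symm, D.ans_eq_of_ansOf_eq heq.1.symm heq.2.2.symm⟩

end Answers

/-! ### The strategy axioms for the composite. -/

section Composition

variable {A B C : Type*}

@[simp] theorem restrict12_embed12 (m : A ⊕ B) :
    restrict12 [(embed12 m : A ⊕ B ⊕ C)] = [m] := by cases m <;> rfl

@[simp] theorem restrict13_embed13 (m : A ⊕ C) :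
    restrict13 [(Sum.map id Sum.inr m : A ⊕ B ⊕ C)] = [m] := by cases m <;> rfl

variable {σ σ' : List (A ⊕ B) → ℂ} {τ τ' : List (B ⊕ C) → ℂ}
variable {G : Game A} {H : Game B} {K : Game C}

local notation "GH" => limp (Game.toGameData G) (Game.toGameData H)
local notation "HK" => limp (Game.toGameData H) (Game.toGameData K)
local notation "GK" => limp (Game.toGameData G) (Game.toGameData K)
local notation "GHK" => limp (Game.toGameData G) (limp (Game.toGameData H) (Game.toGameData K))

theorem isAnswer_embed12 {m : A ⊕ B} : (GHK).IsAnswer (embed12 m) ↔ (GH).IsAnswer m := by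
  cases m <;> rfl

theorem restrict13_mem_maxPos (hσ : (GH).IsStrategy σ) (hτ : (HK).IsStrategy τ)
    {u : List (A ⊕ B ⊕ C)} (hu : par σ τ u ≠ 0) : restrict13 u ∈ (GK).maxPos := by
  have h12 := hσ.mem_space (par_ne_zero_iff.1 hu).1
  have h23 := hτ.mem_space (par_ne_zero_iff.1 hu).2
  refine ⟨?_, by rw [restrictLeft_restrict13]; exact h12.2.1,
    by rw [restrictRight_restrict13]; exact h23.2.2⟩
  refine ((GK).alternating_iff _).2 fun p m hp => ?_
  obtain ⟨w, hw, rfl⟩ := exists_prefix_of_restrict13 hp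
  have cx := (compatible_of_par_ne_zero hu).of_prefix hw
  have cw := cx.of_prefix (List.prefix_append _ _)
  have hab := cw.odd_mid_of_odd_left hσ
  have hbc := cw.odd_right_of_odd_mid hτ
  rw [length_restrict13]
  cases m with
  | inl a =>
    have h1 := cx.odd_mid_of_left_move hσ
    have h2 := G.alternating_step (m := a) (s := restrictLeft (restrict12 w))
      (by simpa using Pref.restrictLeft_mem (hσ.Pref_subset cx.1))
    simp only [limp, limpLabel, Polarity.flip_eq_O_iff, h2]
    grind
  | inr c =>
    have h1 := cx.even_mid_of_right_move hτ
    have h2 := K.alternating_step (m := c) (s := restrictRight (restrict23 w))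
      (by simpa using Pref.restrictRight_mem (hτ.Pref_subset cx.2))
    simp only [limp, limpLabel, h2]
    grind

theorem comp_determinacy (hσ : (GH).IsStrategy σ) (hτ : (HK).IsStrategy τ)
    {s : List (A ⊕ C)} (hs : s ∈ Pref (Function.support (comp σ τ))) (he : Even s.length)
    {m : A ⊕ C} (hm : s ++ [m] ∈ Pref (GK).maxPos) :
    ∃! n, s ++ [m, n] ∈ Pref (Function.support (comp σ τ)) := by
  -- `w` is empty or ends with the last visible move of `s`. As `s` has even length, all three
  -- lengths are then even or all odd: Opponent is to move outside.
  have hex : ∃ w, Compatible σ τ w ∧ restrict13 w = s ∧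
      (Even (restrictLeft (restrict12 w)).length →
        Even (restrictRight (restrict12 w)).length) := by
    obtain ⟨t, ht, hst⟩ := hs
    obtain ⟨u, hu, rfl⟩ := (mem_support_comp_iff hσ hτ).1 ht
    have cu := compatible_of_par_ne_zero hu
    rcases List.eq_nil_or_concat s with rfl | ⟨s, k, rfl⟩
    · exact ⟨[], cu.of_prefix List.nil_prefix, rfl, by simp⟩
    rw [List.concat_eq_append] at *
    obtain ⟨w, hw, rfl⟩ := exists_prefix_of_restrict13 hst
    have cx := cu.of_prefix hw
    refine ⟨_, cx, by simp, ?_⟩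
    have cw := cx.of_prefix (List.prefix_append _ _)
    have hbc := cw.odd_right_of_odd_mid hτ
    rw [List.length_append, length_restrict13] at he
    cases k with
    | inl a =>
      have := cx.odd_mid_of_left_move hσ
      simp at he ⊢
      grind
    | inr c =>
      have := cx.even_mid_of_right_move hτ
      simpa using fun _ => this
  obtain ⟨w, cw, rfl, hpar⟩ := hex
  have hab := cw.odd_mid_of_odd_left hσ
  have hbc := cw.odd_right_of_odd_mid hτ
  have l13 := length_restrict13 w
  have l12 := length_restrict12 w
  have l23 := length_restrict23 w
  have cm : Compatible σ τ (w ++ [Sum.map id Sum.inr m]) := by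
    cases m with
    | inl a =>
      have h1 := odd_right_of_left_move hm
      rw [restrictRight_restrict13] at h1
      refine ⟨?_, by simpa using cw.2⟩
      simp only [Sum.map_inl, id_eq, restrict12_append, restrict12_inl]
      refine hσ.opponent_move cw.1 (by grind)
        (Pref.append_inl (hσ.Pref_subset cw.1) (by grind) ?_)
      simpa [restrictLeft_restrict13] using Pref.restrictLeft_mem hm
    | inr c =>
      have h1 := even_left_of_right_move hm
      rw [restrictLeft_restrict13] at h1
      refine ⟨by simpa using cw.1, ?_⟩
      simp only [Sum.map_inr, restrict23_append, restrict23_inr]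
      refine hτ.opponent_move cw.2 (by grind)
        (Pref.append_inr (hτ.Pref_subset cw.2) (by rw [restrictLeft_restrict23]; exact hpar h1)
          (by grind) ?_)
      simpa [restrictRight_restrict13] using Pref.restrictRight_mem hm
  obtain ⟨u, hwu, hu⟩ := cm.exists_par_ne_zero hσ hτ
  have hpre := restrict13_prefix hwu
  rw [restrict13_append, restrict13_embed13] at hpre
  have heven := limp_even_length (restrict13_mem_maxPos hσ hτ hu)
  obtain ⟨n, hn⟩ := exists_append_singleton_prefix hpre (by
    intro h
    rw [← h, List.length_append, List.length_singleton] at heven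
    grind)
  refine ⟨n, ⟨_, (mem_support_comp_iff hσ hτ).2 ⟨u, hu, rfl⟩, by simpa using hn⟩, ?_⟩
  rintro n' ⟨t, ht, hn'⟩
  obtain ⟨u', hu', rfl⟩ := (mem_support_comp_iff hσ hτ).1 ht
  replace hn' : restrict13 w ++ [m] ++ [n'] <+: restrict13 u' := by simpa using hn'
  by_cases huu : u = u'
  · subst huu
    exact append_singleton_prefix_unique hn' hn
  obtain ⟨r, x, y, hxy, hx, hy, hr⟩ := exists_opponent_divergence hσ hτ hu hu' huu
  have hpre' := prefix_of_append_singleton_prefix hn'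
  -- The parting point `r` has even length. It cannot lie inside the common prefix, nor directly
  -- after `m`, where the length is odd; hence it lies later and both responses sit in the common
  -- part.
  rcases lt_trichotomy r.length (restrict13 w ++ [m]).length with hlt | heq | hlt
  · have h1 := List.prefix_of_prefix_length_le hx hpre (by simp at hlt ⊢; omega)
    have h2 := List.prefix_of_prefix_length_le hy hpre' (by simp at hlt ⊢; omega)
    exact absurd (append_singleton_prefix_unique h1 h2) hxy
  · rw [List.length_append, List.length_singleton] at heq
    grind
  · have h1 := List.prefix_of_prefix_length_le hn (prefix_of_append_singleton_prefix hx)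
      (by simp at hlt ⊢; omega)
    have h2 := List.prefix_of_prefix_length_le hn' (prefix_of_append_singleton_prefix hy)
      (by simp at hlt ⊢; omega)
    exact append_singleton_prefix_unique h2 h1

/-- `t` is kept apart from `restrict12 v` because `v` may be an interaction of equivalent
strategies, with `t` a play of `σ` that merely has the same answers. -/
theorem GameData.IsStrategy.answer_mem12 (hσ : (GH).IsStrategy σ) {t : List (A ⊕ B)}
    (ht : t ∈ Function.support σ) {v : List (A ⊕ B ⊕ C)}
    (htv : (GH).ans t = (GH).ans (restrict12 v)) (s : List (A ⊕ B)) (m : A ⊕ B)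
    (ho : Odd s.length) (hm : s ++ [m] ∈ Pref (Function.support σ))
    (hs : ∀ x ∈ s, (GHK).IsAnswer (embed12 x) → embed12 x ∈ v)
    (ha : (GHK).IsAnswer (embed12 m)) : embed12 m ∈ v := by
  have key : ∀ x, (GH).IsAnswer x → (x ∈ t ↔ embed12 x ∈ v) := by
    intro x hx
    have := Set.ext_iff.1 htv x
    simp only [ans, Set.mem_ofPred_eq, hx, and_true] at this
    rw [this, mem_restrict12]
  rw [isAnswer_embed12] at ha
  exact (key m ha).1 (hσ.answer_mem ht ho hm
    (fun x hx hxa => (key x hxa).2 (hs x hx (isAnswer_embed12.2 hxa))) ha)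

theorem GameData.IsStrategy.answer_mem23 (hτ : (HK).IsStrategy τ) {t : List (B ⊕ C)}
    (ht : t ∈ Function.support τ) {v : List (A ⊕ B ⊕ C)}
    (htv : (HK).ans t = (HK).ans (restrict23 v)) (s : List (B ⊕ C)) (m : B ⊕ C)
    (ho : Odd s.length) (hm : s ++ [m] ∈ Pref (Function.support τ))
    (hs : ∀ x ∈ s, (GHK).IsAnswer (Sum.inr x) → Sum.inr x ∈ v)
    (ha : (GHK).IsAnswer (Sum.inr m)) : Sum.inr m ∈ v := by
  have key : ∀ x, (HK).IsAnswer x → (x ∈ t ↔ Sum.inr x ∈ v) := by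
    intro x hx
    have := Set.ext_iff.1 htv x
    simp only [ans, Set.mem_ofPred_eq, hx, and_true] at this
    rw [this, mem_restrict23]
  exact (key m ha).1 (hτ.answer_mem ht ho hm (fun x hx hxa => (key x hxa).2 (hs x hx hxa)) ha)

/-- The answers of a compatible sequence occur in the complete interaction `v` as soon as those
among its visible Opponent moves do. -/
theorem Compatible.answers_mem (hσ : (GH).IsStrategy σ) (hτ : (HK).IsStrategy τ)
    {v w : List (A ⊕ B ⊕ C)} (hv : par σ τ v ≠ 0) (hw : Compatible σ τ w)
    (h : ∀ p m, p ++ [Sum.map id Sum.inr m] <+: w → Even (restrict13 p).length →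
      (GK).IsAnswer m → m ∈ restrict13 v) :
    ∀ x ∈ w, (GHK).IsAnswer x → x ∈ v := by
  refine hw.forall_mem_of_opponent_moves hσ hτ (fun x => (GHK).IsAnswer x → x ∈ v)
    (hσ.answer_mem12 (par_ne_zero_iff.1 hv).1 rfl) (hτ.answer_mem23 (par_ne_zero_iff.1 hv).2 rfl)
    ?_ ?_
  · intro p a hp ho ha
    have cp := (hw.of_prefix hp).of_prefix (List.prefix_append _ _)
    have h1 := cp.odd_right_of_odd_mid hτ (cp.odd_mid_of_odd_left hσ ho)
    refine inl_mem_restrict13.1 (h p (Sum.inl a) hp ?_ ha)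
    rw [length_restrict13]
    exact ho.add_odd h1
  · intro p c hp he ha
    have cp := (hw.of_prefix hp).of_prefix (List.prefix_append _ _)
    have hab := cp.odd_mid_of_odd_left hσ
    have hbc := cp.odd_right_of_odd_mid hτ
    refine inr_mem_restrict13.1 (h p (Sum.inr c) hp ?_ ha)
    rw [length_restrict13]
    grind

theorem mem_restrict13 {u : List (A ⊕ B ⊕ C)} {x : A ⊕ C} :
    x ∈ restrict13 u ↔ Sum.map id Sum.inr x ∈ u := by
  cases x with
  | inl a => exact inl_mem_restrict13
  | inr c => exact inr_mem_restrict13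

theorem isAnswer_embed13 {m : A ⊕ C} :
    (GHK).IsAnswer (Sum.map id Sum.inr m) ↔ (GK).IsAnswer m := by
  cases m <;> rfl

theorem comp_monotonicity (hσ : (GH).IsStrategy σ) (hτ : (HK).IsStrategy τ)
    {t : List (A ⊕ C)} (ht : t ∈ Function.support (comp σ τ)) {s : List (A ⊕ C)} {m : A ⊕ C}
    (ho : Odd s.length) (hm : s ++ [m] ∈ Pref (Function.support (comp σ τ)))
    (hst : (GK).ans s ⊆ (GK).ans t) : (GK).ans (s ++ [m]) ⊆ (GK).ans t := by
  obtain ⟨v, hv, rfl⟩ := (mem_support_comp_iff hσ hτ).1 ht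
  obtain ⟨_, hr, hsr⟩ := hm
  obtain ⟨u, hu, rfl⟩ := (mem_support_comp_iff hσ hτ).1 hr
  obtain ⟨w, hw, rfl⟩ := exists_prefix_of_restrict13 hsr
  have key := ((compatible_of_par_ne_zero hu).of_prefix hw).answers_mem hσ hτ hv (by
    -- The final move `m` stands after an odd number of visible moves, so it is not Opponent's; all
    -- visible Opponent answers lie in the earlier part, where `hst` applies.
    intro p k hp he hk
    rw [List.prefix_concat_iff] at hp
    rcases hp with hp | hp
    · rw [(List.append_inj' hp rfl).1] at he
      grind
    · refine (hst ⟨?_, hk⟩).1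
      simpa using mem_of_append_singleton_prefix (by simpa using restrict13_prefix hp))
  rintro x ⟨hx, ha⟩
  refine ⟨mem_restrict13.2 (key _ ?_ (isAnswer_embed13.2 ha)), ha⟩
  rw [← mem_restrict13]
  simpa using hx

theorem exists_later_move12 {u w : List (A ⊕ B ⊕ C)} (hw : w <+: u) {r : List (A ⊕ B)} {n : A ⊕ B}
    (h : restrict12 w ++ r ++ [n] <+: restrict12 u) :
    ∃ p, w <+: p ∧ p ++ [embed12 n] <+: u := by
  obtain ⟨p, hp, hpr⟩ := exists_prefix_of_restrict12 h
  rcases List.prefix_or_prefix_of_prefix hw hp with h' | h'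
  · rw [List.prefix_concat_iff] at h'
    rcases h' with rfl | h'
    · have := congrArg List.length hpr
      simp at this
    · exact ⟨p, h', hp⟩
  · have := (restrict12_prefix h').length_le
    simp [hpr] at this

theorem exists_later_move23 {u w : List (A ⊕ B ⊕ C)} (hw : w <+: u) {r : List (B ⊕ C)} {n : B ⊕ C}
    (h : restrict23 w ++ r ++ [n] <+: restrict23 u) :
    ∃ p, w <+: p ∧ p ++ [Sum.inr n] <+: u := by
  obtain ⟨p, hp, hpr⟩ := exists_prefix_of_restrict23 h
  rcases List.prefix_or_prefix_of_prefix hw hp with h' | h'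
  · rw [List.prefix_concat_iff] at h'
    rcases h' with rfl | h'
    · have := congrArg List.length hpr
      simp at this
    · exact ⟨p, h', hp⟩
  · have := (restrict23_prefix h').length_le
    simp [hpr] at this

/-- Incoherent answers are passed on between the strategies until they become visible. -/
theorem exists_visible_incoherence (hσ : (GH).IsStrategy σ) (hτ : (HK).IsStrategy τ)
    {u u' : List (A ⊕ B ⊕ C)} (hu : par σ τ u ≠ 0) (hu' : par σ τ u' ≠ 0) (N : ℕ) :
    (∀ w w' m m', w ++ [embed12 m] <+: u → w' ++ [embed12 m'] <+: u' → u.length ≤ w.length + N →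
      (GH).IsAnswerOf Polarity.O m → (GH).IsAnswerOf Polarity.O m' → ¬ (GH).coh m m' →
      ∃ p p' n n', w ++ [embed12 m] <+: p ∧ w' ++ [embed12 m'] <+: p' ∧
        p ++ [Sum.map id Sum.inr n] <+: u ∧ p' ++ [Sum.map id Sum.inr n'] <+: u' ∧
        (GK).IsAnswerOf Polarity.P n ∧ (GK).IsAnswerOf Polarity.P n' ∧ ¬ (GK).coh n n') ∧
    (∀ w w' m m', w ++ [Sum.inr m] <+: u → w' ++ [Sum.inr m'] <+: u' →
      u.length ≤ w.length + N →
      (HK).IsAnswerOf Polarity.O m → (HK).IsAnswerOf Polarity.O m' → ¬ (HK).coh m m' →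
      ∃ p p' n n', w ++ [Sum.inr m] <+: p ∧ w' ++ [Sum.inr m'] <+: p' ∧
        p ++ [Sum.map id Sum.inr n] <+: u ∧ p' ++ [Sum.map id Sum.inr n'] <+: u' ∧
        (GK).IsAnswerOf Polarity.P n ∧ (GK).IsAnswerOf Polarity.P n' ∧ ¬ (GK).coh n n') := by
  induction N with
  | zero =>
    constructor <;>
    · intro w w' m m' h _ hle
      have := h.length_le
      simp at this
      omega
  | succ N ih =>
    have cu := compatible_of_par_ne_zero hu
    have cu' := compatible_of_par_ne_zero hu'
    have hflip : ∀ q : Polarity × Kind, (q.1.flip, q.2) = (Polarity.O, Kind.A) ↔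
        q = (Polarity.P, Kind.A) := by
      rintro ⟨p, k⟩; cases p <;> simp [Polarity.flip]
    have hflip' : ∀ q : Polarity × Kind, (q.1.flip, q.2) = (Polarity.P, Kind.A) ↔
        q = (Polarity.O, Kind.A) := by
      rintro ⟨p, k⟩; cases p <;> simp [Polarity.flip]
    constructor
    · intro w w' m m' h h' hle hm hm' hcoh
      obtain ⟨r, r', n, n', hr, hr', hn, hn', hnn⟩ := hσ.incoherence_preservation
        (restrict12 w) (restrict12 w') m m' (by simpa using (cu.of_prefix h).1)
        (by simpa using (cu'.of_prefix h').1) hm hm' hcoh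
        (restrict12 u) ⟨cu.1, hσ.mem_space (par_ne_zero_iff.1 hu).1⟩
        (restrict12 u') ⟨cu'.1, hσ.mem_space (par_ne_zero_iff.1 hu').1⟩
        (by simpa using restrict12_prefix h) (by simpa using restrict12_prefix h')
      obtain ⟨p, hp, hpn⟩ := exists_later_move12 h (r := r) (n := n) (by simpa using hr)
      obtain ⟨p', hp', hpn'⟩ := exists_later_move12 h' (r := r') (n := n') (by simpa using hr')
      rcases not_limpCoh_cases hn hn' hnn with ⟨a, a', rfl, rfl, hc⟩ | ⟨b, b', rfl, rfl, hc⟩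
      · exact ⟨p, p', Sum.inl a, Sum.inl a', hp, hp', hpn, hpn', hn, hn', hc⟩
      -- Player answers of `σ` in H are Opponent answers for `τ`. They occur strictly later in `u`,
      -- so the remaining length has dropped.
      · obtain ⟨q, q', k, k', hq, hq', hk⟩ := ih.2 p p' (Sum.inl b) (Sum.inl b') hpn hpn'
          (by have := hp.length_le; simp at this; omega)
          ((hflip (H.label b)).2 hn) ((hflip (H.label b')).2 hn') hc
        exact ⟨q, q', k, k', hp.trans (prefix_of_append_singleton_prefix hq),
          hp'.trans (prefix_of_append_singleton_prefix hq'), hk⟩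
    · intro w w' m m' h h' hle hm hm' hcoh
      obtain ⟨r, r', n, n', hr, hr', hn, hn', hnn⟩ := hτ.incoherence_preservation
        (restrict23 w) (restrict23 w') m m' (by simpa using (cu.of_prefix h).2)
        (by simpa using (cu'.of_prefix h').2) hm hm' hcoh
        (restrict23 u) ⟨cu.2, hτ.mem_space (par_ne_zero_iff.1 hu).2⟩
        (restrict23 u') ⟨cu'.2, hτ.mem_space (par_ne_zero_iff.1 hu').2⟩
        (by simpa using restrict23_prefix h) (by simpa using restrict23_prefix h')
      obtain ⟨p, hp, hpn⟩ := exists_later_move23 h (r := r) (n := n) (by simpa using hr)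
      obtain ⟨p', hp', hpn'⟩ := exists_later_move23 h' (r := r') (n := n') (by simpa using hr')
      rcases not_limpCoh_cases hn hn' hnn with ⟨b, b', rfl, rfl, hc⟩ | ⟨c, c', rfl, rfl, hc⟩
      · obtain ⟨q, q', k, k', hq, hq', hk⟩ := ih.1 p p' (Sum.inr b) (Sum.inr b') hpn hpn'
          (by have := hp.length_le; simp at this; omega)
          ((hflip' (H.label b)).1 hn)
          ((hflip' (H.label b')).1 hn') hc
        exact ⟨q, q', k, k', hp.trans (prefix_of_append_singleton_prefix hq),
          hp'.trans (prefix_of_append_singleton_prefix hq'), hk⟩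
      · exact ⟨p, p', Sum.inr c, Sum.inr c', hp, hp', hpn, hpn', hn, hn', hc⟩

theorem comp_incoherence_preservation (hσ : (GH).IsStrategy σ) (hτ : (HK).IsStrategy τ)
    {u u' : List (A ⊕ B ⊕ C)} (hu : par σ τ u ≠ 0) (hu' : par σ τ u' ≠ 0)
    {s s' : List (A ⊕ C)} {m m' : A ⊕ C} (hs : s ++ [m] <+: restrict13 u)
    (hs' : s' ++ [m'] <+: restrict13 u') (hm : (GK).IsAnswerOf Polarity.O m)
    (hm' : (GK).IsAnswerOf Polarity.O m') (hcoh : ¬ (GK).coh m m') :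
    ∃ (r r' : List (A ⊕ C)) (n n' : A ⊕ C),
      s ++ [m] ++ r ++ [n] <+: restrict13 u ∧ s' ++ [m'] ++ r' ++ [n'] <+: restrict13 u' ∧
      (GK).IsAnswerOf Polarity.P n ∧ (GK).IsAnswerOf Polarity.P n' ∧ ¬ (GK).coh n n' := by
  obtain ⟨w, hw, rfl⟩ := exists_prefix_of_restrict13 hs
  obtain ⟨w', hw', rfl⟩ := exists_prefix_of_restrict13 hs'
  have key : ∃ p p' n n', w ++ [Sum.map id Sum.inr m] <+: p ∧ w' ++ [Sum.map id Sum.inr m'] <+: p' ∧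
      p ++ [Sum.map id Sum.inr n] <+: u ∧ p' ++ [Sum.map id Sum.inr n'] <+: u' ∧
      (GK).IsAnswerOf Polarity.P n ∧ (GK).IsAnswerOf Polarity.P n' ∧ ¬ (GK).coh n n' := by
    have h := exists_visible_incoherence hσ hτ hu hu' u.length
    rcases not_limpCoh_cases hm hm' hcoh with ⟨a, a', rfl, rfl, hc⟩ | ⟨c, c', rfl, rfl, hc⟩
    · exact h.1 w w' (Sum.inl a) (Sum.inl a') hw hw' (by omega) hm hm' hc
    · exact h.2 w w' (Sum.inr c) (Sum.inr c') hw hw' (by omega) hm hm' hc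
  obtain ⟨p, p', n, n', hp, hp', hpn, hpn', hrest⟩ := key
  obtain ⟨r, hr⟩ := restrict13_prefix hp
  obtain ⟨r', hr'⟩ := restrict13_prefix hp'
  rw [restrict13_append, restrict13_embed13] at hr hr'
  refine ⟨r, r', n, n', ?_, ?_, hrest⟩
  · rw [hr]; simpa using restrict13_prefix hpn
  · rw [hr']; simpa using restrict13_prefix hpn'

theorem comp_isStrategy (hσ : (GH).IsStrategy σ) (hτ : (HK).IsStrategy τ) :
    (GK).IsStrategy (comp σ τ) := by
  have hmem : Function.support (comp σ τ) ⊆ (GK).maxPos := by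
    intro s hs
    obtain ⟨u, hu, rfl⟩ := (mem_support_comp_iff hσ hτ).1 hs
    exact restrict13_mem_maxPos hσ hτ hu
  have hmax : ∀ t ∈ Pref (Function.support (comp σ τ)) ∩ (GK).maxPos,
      ∃ u, par σ τ u ≠ 0 ∧ restrict13 u = t := by
    rintro t ⟨⟨r, hr, htr⟩, ht⟩
    rw [limp_maximal ht (hmem hr) htr]
    exact (mem_support_comp_iff hσ hτ).1 hr
  refine ⟨hmem, fun s hs he m hm => comp_determinacy hσ hτ hs he hm,
    fun t ht s m ho hm h => comp_monotonicity hσ hτ ht ho hm h, ?_⟩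
  intro s s' m m' _ _ hm hm' hcoh t ht t' ht' hst hst'
  obtain ⟨u, hu, rfl⟩ := hmax t ht
  obtain ⟨u', hu', rfl⟩ := hmax t' ht'
  exact comp_incoherence_preservation hσ hτ hu hu' hst hst' hm hm' hcoh

/-! ### Invariance under extensional equivalence. -/

theorem ans_restrict_eq {u v : List (A ⊕ B ⊕ C)}
    (h : ∀ x, (GHK).IsAnswer x → (x ∈ u ↔ x ∈ v)) :
    (GH).ans (restrict12 u) = (GH).ans (restrict12 v) ∧
    (HK).ans (restrict23 u) = (HK).ans (restrict23 v) ∧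
    (GK).ans (restrict13 u) = (GK).ans (restrict13 v) := by
  refine ⟨?_, ?_, ?_⟩ <;> ext x <;> refine and_congr_left fun ha => ?_
  · rw [mem_restrict12, mem_restrict12, h _ (isAnswer_embed12.2 ha)]
  · rw [mem_restrict23, mem_restrict23, h (Sum.inr x) ha]
  · rw [mem_restrict13, mem_restrict13, h _ (isAnswer_embed13.2 ha)]

/-- Equal visible answers force equal hidden answers, by monotonicity in both directions, so each
factor of the scalar agrees. -/
theorem comp_scalarWellDefined (hσ : (GH).IsStrategy σ) (hτ : (HK).IsStrategy τ)
    (hσw : (GH).ScalarWellDefined σ) (hτw : (HK).ScalarWellDefined τ) :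
    (GK).ScalarWellDefined (comp σ τ) := by
  intro s t hs ht hO hP
  obtain ⟨u, hu, rfl⟩ := (mem_support_comp_iff hσ hτ).1 hs
  obtain ⟨v, hv, rfl⟩ := (mem_support_comp_iff hσ hτ).1 ht
  have hans := (GK).ans_eq_of_ansOf_eq hO hP
  have key : ∀ {u v}, par σ τ u ≠ 0 → par σ τ v ≠ 0 →
      (GK).ans (restrict13 u) = (GK).ans (restrict13 v) →
      ∀ x ∈ u, (GHK).IsAnswer x → x ∈ v := by
    intro u v hu hv h
    refine (compatible_of_par_ne_zero hu).answers_mem hσ hτ hv fun p m hp _ ha => ?_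
    have : m ∈ (GK).ans (restrict13 u) :=
      ⟨mem_restrict13.2 (mem_of_append_singleton_prefix hp), ha⟩
    rw [h] at this
    exact this.1
  obtain ⟨h12, h23, -⟩ := ans_restrict_eq (u := u) (v := v) fun x ha =>
    ⟨fun hx => key hu hv hans x hx ha, fun hx => key hv hu hans.symm x hx ha⟩
  rw [comp_restrict13 hσ hτ hu, comp_restrict13 hσ hτ hv, par, par,
    hσw.eq_of_ans_eq (par_ne_zero_iff.1 hu).1 (par_ne_zero_iff.1 hv).1 h12,
    hτw.eq_of_ans_eq (par_ne_zero_iff.1 hu).2 (par_ne_zero_iff.1 hv).2 h23]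

theorem exists_interaction_with_same_answers (hσ : (GH).IsStrategy σ) (hτ : (HK).IsStrategy τ)
    {u : List (A ⊕ B ⊕ C)} (h12 : restrict12 u ∈ (GH).maxPos) (h23 : restrict23 u ∈ (HK).maxPos)
    {s : List (A ⊕ B)} (hs : s ∈ Function.support σ)
    (hsu : (GH).ans s = (GH).ans (restrict12 u))
    {t : List (B ⊕ C)} (ht : t ∈ Function.support τ)
    (htu : (HK).ans t = (HK).ans (restrict23 u)) :
    ∃ v, par σ τ v ≠ 0 ∧ ∀ x, (GHK).IsAnswer x → (x ∈ v ↔ x ∈ u) := by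
  obtain ⟨v, -, hv, hvu⟩ := Compatible.exists_extension hσ hτ
    (fun x => (GHK).IsAnswer x → x ∈ u) (hσ.answer_mem12 hs hsu) (hτ.answer_mem23 ht htu)
    (fun p hp hpm hx => by
      obtain ⟨m, hm, hmu⟩ := GameData.exists_move_within G.isGame h12.2.1 hp hpm
        fun x hxp ha => mem_restrictLeft.2 (mem_restrict12.2 (hx x hxp ha))
      exact ⟨m, hm, fun ha => mem_restrict12.1 (mem_restrictLeft.1 (hmu ha))⟩)
    (fun p hp hpm hx => by
      obtain ⟨m, hm, hmu⟩ := GameData.exists_move_within K.isGame h23.2.2 hp hpm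
        fun x hxp ha => mem_restrictRight.2 (mem_restrict23.2 (hx x hxp ha))
      exact ⟨m, hm, fun ha => mem_restrict23.1 (mem_restrictRight.1 (hmu ha))⟩)
    (w := []) ⟨⟨s, hs, List.nil_prefix⟩, ⟨t, ht, List.nil_prefix⟩⟩ (by simp)
  have v12 := hσ.mem_space (par_ne_zero_iff.1 hv).1
  have v23 := hτ.mem_space (par_ne_zero_iff.1 hv).2
  -- The inclusion of answers already holds; in each component both restrictions are maximal
  -- positions, so it is an equality.
  refine ⟨v, hv, fun x ha => ⟨fun hx => hvu x hx ha, fun hx => ?_⟩⟩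
  rcases x with a | b | c
  · have := GameData.ans_eq_of_subset G.isGame v12.2.1 h12.2.1 fun y hy =>
      ⟨mem_restrictLeft.2 (mem_restrict12.2
        (hvu _ (mem_restrict12.1 (mem_restrictLeft.1 hy.1)) hy.2)), hy.2⟩
    have h : a ∈ G.toGameData.ans (restrictLeft (restrict12 u)) :=
      ⟨mem_restrictLeft.2 (mem_restrict12.2 hx), ha⟩
    rw [← this] at h
    exact mem_restrict12.1 (mem_restrictLeft.1 h.1)
  · have := GameData.ans_eq_of_subset H.isGame v12.2.2 h12.2.2 fun y hy =>
      ⟨mem_restrictRight.2 (mem_restrict12.2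
        (hvu _ (mem_restrict12.1 (mem_restrictRight.1 hy.1)) hy.2)), hy.2⟩
    have h : b ∈ H.toGameData.ans (restrictRight (restrict12 u)) :=
      ⟨mem_restrictRight.2 (mem_restrict12.2 hx), ha⟩
    rw [← this] at h
    exact mem_restrict12.1 (mem_restrictRight.1 h.1)
  · have := GameData.ans_eq_of_subset K.isGame v23.2.2 h23.2.2 fun y hy =>
      ⟨mem_restrictRight.2 (mem_restrict23.2
        (hvu _ (mem_restrict23.1 (mem_restrictRight.1 hy.1)) hy.2)), hy.2⟩
    have h : c ∈ K.toGameData.ans (restrictRight (restrict23 u)) :=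
      ⟨mem_restrictRight.2 (mem_restrict23.2 hx), ha⟩
    rw [← this] at h
    exact mem_restrict23.1 (mem_restrictRight.1 h.1)

theorem comp_fnGraph_subset (hσ : (GH).IsStrategy σ) (hτ : (HK).IsStrategy τ)
    (hσ' : (GH).IsStrategy σ') (hτ' : (HK).IsStrategy τ') (hσσ' : (GH).ExtEquiv σ σ')
    (hττ' : (HK).ExtEquiv τ τ') : (GK).fnGraph (comp σ τ) ⊆ (GK).fnGraph (comp σ' τ') := by
  rintro _ ⟨s, hs, rfl⟩
  obtain ⟨u, hu, rfl⟩ := (mem_support_comp_iff hσ hτ).1 hs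
  have hu' := par_ne_zero_iff.1 hu
  -- `p` and `q` need not agree on H, so they need not form an interaction. They only bound the
  -- answers of `σ'` and `τ'` and supply the scalars; the interaction `v` is built separately.
  obtain ⟨p, hp, hpu, hpans⟩ := hσσ'.exists_play hu'.1
  obtain ⟨q, hq, hqu, hqans⟩ := hττ'.exists_play hu'.2
  obtain ⟨v, hv, hvu⟩ := exists_interaction_with_same_answers hσ' hτ' (hσ.mem_space hu'.1)
    (hτ.mem_space hu'.2) hp hpans hq hqans
  obtain ⟨h12, h23, h13⟩ := ans_restrict_eq hvu
  have hv' := par_ne_zero_iff.1 hv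
  have heq : comp σ' τ' (restrict13 v) = comp σ τ (restrict13 u) := by
    rw [comp_restrict13 hσ' hτ' hv, comp_restrict13 hσ hτ hu, par, par, ← hpu, ← hqu,
      hσσ'.2.1.eq_of_ans_eq hv'.1 hp (h12.trans hpans.symm),
      hττ'.2.1.eq_of_ans_eq hv'.2 hq (h23.trans hqans.symm)]
  refine ⟨restrict13 v, (mem_support_comp_iff hσ' hτ').2 ⟨v, hv, rfl⟩, ?_⟩
  rw [heq, (GK).ansOf_eq_of_ans_eq h13, (GK).ansOf_eq_of_ans_eq h13]

theorem comp_extEquiv (hσ : (GH).IsStrategy σ) (hτ : (HK).IsStrategy τ)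
    (hσ' : (GH).IsStrategy σ') (hτ' : (HK).IsStrategy τ') (hσσ' : (GH).ExtEquiv σ σ')
    (hττ' : (HK).ExtEquiv τ τ') : (GK).ExtEquiv (comp σ τ) (comp σ' τ') :=
  ⟨comp_scalarWellDefined hσ hτ hσσ'.1 hττ'.1,
    comp_scalarWellDefined hσ' hτ' hσσ'.2.1 hττ'.2.1,
    (comp_fnGraph_subset hσ hτ hσ' hτ' hσσ' hττ').antisymm
      (comp_fnGraph_subset hσ' hτ' hσ hτ hσσ'.symm hττ'.symm)⟩

end Composition

end QGames

theorem mainTheorem2 {A B C : Type*}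
    (G : QGames.Game A) (H : QGames.Game B) (K : QGames.Game C)
    (σ σ' : List (A ⊕ B) → ℂ) (τ τ' : List (B ⊕ C) → ℂ)
    (hσ : (QGames.limp G.toGameData H.toGameData).IsStrategy σ)
    (hσ' : (QGames.limp G.toGameData H.toGameData).IsStrategy σ')
    (hτ : (QGames.limp H.toGameData K.toGameData).IsStrategy τ)
    (hτ' : (QGames.limp H.toGameData K.toGameData).IsStrategy τ') :
    (QGames.limp G.toGameData K.toGameData).IsStrategy (QGames.comp σ τ) ∧
    (QGames.limp G.toGameData K.toGameData).IsStrategy (QGames.comp σ' τ') ∧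
    ((QGames.limp G.toGameData H.toGameData).ExtEquiv σ σ' →
      (QGames.limp H.toGameData K.toGameData).ExtEquiv τ τ' →
      (QGames.limp G.toGameData K.toGameData).ExtEquiv
        (QGames.comp σ τ) (QGames.comp σ' τ')) :=
  ⟨QGames.comp_isStrategy hσ hτ, QGames.comp_isStrategy hσ' hτ',
    QGames.comp_extEquiv hσ hτ hσ' hτ'⟩
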